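/- A triangle of a graph is a set of three pairwise adjacent vertices. For finite graphs $F$ and $G$, write $G \to_{\mathrm{ind}} (F)^{\Delta}$ if for every colouring of the triangles of $G$ with two colours there is an induced subgraph of $G$ isomorphic to $F$ all of whose triangles have the same colour. Let $R_{\mathrm{ind}}^{\Delta}(F)$ be the smallest integer $N$ for which there is a graph $G$ on $N$ vertices with $G \to_{\mathrm{ind}} (F)^{\Delta}$. For $n \ge 1$ let $\mathcal{B}_n$ be the family of graphs $F$ on the vertex set $[n]=\{1,\dots,n\}$ whose vertex set can be partitioned as $A \cup B$ (either part may be empty) such that the induced subgraph $F[A]$ is triangle-free and $B$ is an independent set (the edges between $A$ and $B$ being arbitrary). Theorem. There is an absolute constant $c > 0$ such that for every $n \ge 1$ and every $F \in \mathcal{B}_n$ the number $R_{\mathrm{ind}}^{\Delta}(F)$ exists and $$R_{\mathrm{ind}}^{\Delta}(F) \le 2^{2^{c n \log_2 n}}.$$ -/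

import Mathlib

namespace TriangleRamsey

/-- The induced triangle arrow: for every colouring `χ` of the triangles of `G` with two colours
there is an induced copy `φ` of `F` in `G` all of whose triangles receive one and the same
colour. -/
def Arrows {V W : Type*} (G : SimpleGraph W) (F : SimpleGraph V) : Prop :=
  ∀ χ : G.cliqueSet 3 → Fin 2, ∃ φ : F ↪g G, ∃ b : Fin 2,
    ∀ t : G.cliqueSet 3, ((t : Finset W) : Set W) ⊆ Set.range φ → χ t = b

/-- The set of all `N` such that some graph on `N` vertices arrows `F`. -/
def ramseySizes {V : Type*} (F : SimpleGraph V) : Set ℕ :=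
  {N : ℕ | ∃ G : SimpleGraph (Fin N), Arrows G F}

/-- The induced triangle Ramsey number of `F`: the least number of vertices of a graph that
arrows `F` (it has this meaning when `ramseySizes F` is nonempty). -/
noncomputable def ramseyNumber {V : Type*} (F : SimpleGraph V) : ℕ :=
  sInf (ramseySizes F)

/-- The graphs on `n` vertices whose vertex set splits into two disjoint sets `A` and `B` such that
the subgraph induced on `A` is triangle-free and `B` is independent. -/
def classB (n : ℕ) : Set (SimpleGraph (Fin n)) :=
  {F | ∃ A B : Set (Fin n), A ∪ B = Set.univ ∧ Disjoint A B ∧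
    (F.induce A).CliqueFree 3 ∧ F.IsIndepSet B}

end TriangleRamsey

/-!
The proof has two parts.

*Reduction of triangles to edges.* Let `H` be a graph on `r` vertices such that every 2-colouring of
its edges has a monochromatic induced copy of `F`. Blow up every vertex of `H` to `t` points, and
for every section `S` of the blow-up add a vertex `w_S` joined to the `r` points of `S`; the `w_S`
are independent (`sectionGraph`). A 2-colouring of the triangles gives, for each `S`, a 2-colouring
of the edges of `H` inside `S`. By averaging there is one 2-colouring `g` of the edges of the blow-up
that induces all of these for a fraction `2 ^ (-r ^ 2)` of the sections
(`exists_popular_colouring`). For `t` much larger than `2 ^ (r ^ 2)`, a family of sections this dense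
shatters some section `u`: every subset of `u` is `u ∩ S` for some `S` in the family
(`exists_shattered`). Now `g` colours the copy of `H` on `u`, so there is a monochromatic copy of `F`
in it. Keep the vertices of `A` from that copy, and as image of `b ∈ B` take `w_S`, where `S ∩ u`
consists of the neighbours of `b` in `A` (and of the point for `b` itself). Since `F[A]` is
triangle-free and `B` is independent, every triangle of `F` has exactly one vertex in `B`, and its
colour is that of an edge under `g` (`arrows_sectionGraph`). The graph has `r * t + t ^ r` vertices,
which is `2 ^ r ^ O(1)`.

*Induced Ramsey numbers for edges.* It remains to find `H` with `r = 2 ^ O(n * log n)`, which is a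
theorem of Conlon, Fox and Sudakov; `H` can be the symplectic graph over `𝔽₂`, which is pseudo-random
by Parseval's identity (`pseudoRandom_symplGraph`). Let `n ≤ k = 2 ^ h`. If one colour is bi-dense in
a set, a copy in that colour can be embedded there greedily. Otherwise this colour is sparse between
two large subsets, and it is enough to find half of a copy in the other colour in each of them.
Looking for `s` vertices in one colour or `t` in the other, one halves the larger of `s` and `t`, so
that the losses `k ^ O(s)` of the successive steps form a geometric progression; each step loses a
further factor `2 ^ O(k)`, and there are `2 * h` of them. The outcome is a sequence of sets, called a
ladder here, in which consecutive blocks are bi-dense in one colour and the other colour is sparse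
between different blocks (`ladder_or_ladder`). Along a ladder any graph is embedded vertex by vertex.
Pseudo-randomness makes adjacency to the vertex just chosen nearly independent of the neighbourhoods
in the wrong colour, so these stay sparse relative to the shrinking candidate sets
(`Candidates.exists_next`, `Ladder.exists_copy`).
-/

/-! ### Sections agreeing with one function in prescribed places -/

namespace TriangleRamsey

open Finset

/-- If a family `𝒮` of functions `Fin r → Fin t` has more than `r * t ^ (r - 1)` members, then some
function `u` is shattered by it: every set of coordinates is the exact set of agreement with `u`
of a member of `𝒮`. -/
lemma exists_shattered {t : ℕ} (ht : 0 < t) (r : ℕ) (𝒮 : Finset (Fin r → Fin t))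
    (h : r * t ^ r < t * #𝒮) :
    ∃ u : Fin r → Fin t, ∀ N : Set (Fin r), ∃ S ∈ 𝒮, ∀ x, S x = u x ↔ x ∈ N := by
  classical
  induction r with
  | zero =>
    have : 𝒮.Nonempty := by
      rw [← card_pos]
      by_contra h0
      simp_all
    obtain ⟨S, hS⟩ := this
    exact ⟨S, fun N => ⟨S, hS, fun x => x.elim0⟩⟩
  | succ r ih =>
    have h1 : (r + 1) * t ^ r < #𝒮 := by
      have : t * ((r + 1) * t ^ r) < t * #𝒮 := by
        calc t * ((r + 1) * t ^ r) = (r + 1) * t ^ (r + 1) := by ring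
          _ < _ := h
      exact lt_of_mul_lt_mul_left this (Nat.zero_le _)
    -- the members that can be changed in the first coordinate alone
    set 𝒮' : Finset (Fin (r + 1) → Fin t) :=
      𝒮.filter fun S => ∃ v, v ≠ S 0 ∧ Fin.cons v (Fin.tail S) ∈ 𝒮 with h𝒮'
    have h2 : #(𝒮 \ 𝒮') ≤ t ^ r := by
      have : #(𝒮 \ 𝒮') ≤ #(univ : Finset (Fin r → Fin t)) := by
        refine card_le_card_of_injOn Fin.tail (fun _ _ => by simp) ?_
        intro S hS S₁ hS₁ hSS
        simp only [h𝒮', coe_sdiff, Set.mem_sdiff, mem_coe, mem_filter, not_and, not_exists] at hS hS₁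
        by_contra hne
        refine hS.2 hS.1 (S₁ 0) ?_ ?_
        · intro h0
          apply hne
          rw [← Fin.cons_self_tail S, ← Fin.cons_self_tail S₁, hSS, h0]
        · rw [hSS, Fin.cons_self_tail]
          exact hS₁.1
      simpa using this
    have h3 : r * t ^ r < #𝒮' := by
      have h4 : #𝒮 = #(𝒮 \ 𝒮') + #𝒮' :=
        (card_sdiff_add_card_eq_card (filter_subset _ _)).symm
      have : (r + 1) * t ^ r = r * t ^ r + t ^ r := by ring
      omega
    obtain ⟨v, -, hv⟩ : ∃ v ∈ (univ : Finset (Fin t)),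
        r * t ^ r < t * #(𝒮'.filter fun S => S 0 = v) := by
      by_contra! hcon
      have h5 : #𝒮' = ∑ v : Fin t, #(𝒮'.filter fun S => S 0 = v) :=
        card_eq_sum_card_fiberwise (fun _ _ => by simp)
      have h6 : t * #𝒮' ≤ t * (r * t ^ r) := by
        rw [h5, mul_sum]
        exact (sum_le_sum hcon).trans (by simp)
      exact absurd (le_of_mul_le_mul_left h6 ht) (not_le.2 h3)
    have h7 : #((𝒮'.filter fun S => S 0 = v).image Fin.tail)
        = #(𝒮'.filter fun S => S 0 = v) := by
      refine card_image_of_injOn ?_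
      intro S hS S₁ hS₁ hSS
      simp only [coe_filter, Set.mem_ofPred_eq] at hS hS₁
      rw [← Fin.cons_self_tail S, ← Fin.cons_self_tail S₁, hSS, hS.2, hS₁.2]
    obtain ⟨u, hu⟩ := ih ((𝒮'.filter fun S => S 0 = v).image Fin.tail) (by rw [h7]; exact hv)
    refine ⟨Fin.cons v u, fun N => ?_⟩
    obtain ⟨S', hS', hSN⟩ := hu {x | x.succ ∈ N}
    obtain ⟨S, hS, rfl⟩ := mem_image.1 hS'
    rw [mem_filter, h𝒮', mem_filter] at hS
    obtain ⟨⟨hS1, v', hv', hS2⟩, hS0⟩ := hS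
    by_cases h0 : (0 : Fin (r + 1)) ∈ N
    · refine ⟨S, hS1, fun x => ?_⟩
      refine Fin.cases ?_ (fun y => ?_) x
      · simp [hS0, h0]
      · simpa [Fin.tail] using hSN y
    · refine ⟨_, hS2, fun x => ?_⟩
      refine Fin.cases ?_ (fun y => ?_) x
      · simp [h0, ← hS0, hv']
      · simpa using hSN y

/-- Averaging over all `g`: some colouring `g` of the pairs of points of `X × T` is compatible with
a fraction `2 ^ (-|X| ^ 2)` of all sections `S : X → T`. -/
lemma exists_popular_colouring {X T : Type*} [Fintype X] [Fintype T] (col : (X → T) → X → X → Fin 2) :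
    ∃ (g : (X × X) × (T × T) → Fin 2) (𝒮 : Finset (X → T)),
      (∀ S ∈ 𝒮, ∀ x y, col S x y = g ((x, y), (S x, S y))) ∧
      Fintype.card T ^ Fintype.card X ≤ 2 ^ (Fintype.card X ^ 2) * #𝒮 := by
  classical
  set Q := (X × X) × (T × T)
  have key : ∀ S : X → T, 2 ^ Fintype.card Q ≤ 2 ^ (Fintype.card X ^ 2) *
      #(univ.filter fun g : Q → Fin 2 => ∀ x y, col S x y = g ((x, y), (S x, S y))) := by
    intro S
    set A : Q → Finset (Fin 2) := fun q =>
      if q.2 = (S q.1.1, S q.1.2) then {col S q.1.1 q.1.2} else univ with hA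
    have h1 : (univ.filter fun g : Q → Fin 2 => ∀ x y, col S x y = g ((x, y), (S x, S y)))
        = Fintype.piFinset A := by
      ext g
      simp only [mem_filter, mem_univ, true_and, Fintype.mem_piFinset, hA]
      constructor
      · rintro h ⟨⟨x, y⟩, p⟩
        by_cases hp : p = (S x, S y)
        · subst hp; simp [h x y]
        · simp [hp]
      · intro h x y
        have := h ((x, y), (S x, S y))
        simp at this
        exact this.symm
    rw [h1, Fintype.card_piFinset]
    have h2 : (2 : ℕ) ^ (Fintype.card X ^ 2)
        = ∏ q : Q, (if q.2 = (S q.1.1, S q.1.2) then 2 else 1) := by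
      rw [prod_ite]
      simp only [prod_const, one_pow, mul_one]
      congr 1
      rw [← Fintype.card_subtype]
      have e : {q : Q // q.2 = (S q.1.1, S q.1.2)} ≃ X × X :=
        { toFun := fun q => q.1.1
          invFun := fun p => ⟨(p, (S p.1, S p.2)), rfl⟩
          left_inv := by rintro ⟨⟨p, q⟩, h⟩; simp only at h; subst h; rfl
          right_inv := fun p => rfl }
      rw [Fintype.card_congr e, Fintype.card_prod, sq]
    rw [h2, ← prod_mul_distrib]
    have h3 : (2 : ℕ) ^ Fintype.card Q = ∏ _q : Q, 2 := by simp
    rw [h3]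
    refine prod_le_prod' fun q _ => ?_
    by_cases hq : q.2 = (S q.1.1, S q.1.2) <;> simp [hA, hq]
  suffices h : ∃ g : Q → Fin 2, Fintype.card T ^ Fintype.card X ≤ 2 ^ (Fintype.card X ^ 2) *
      #(univ.filter fun S : X → T => ∀ x y, col S x y = g ((x, y), (S x, S y))) by
    obtain ⟨g, hg⟩ := h
    exact ⟨g, _, fun S hS => (mem_filter.1 hS).2, hg⟩
  by_contra! hcon
  have h1 : ∑ g : Q → Fin 2, 2 ^ (Fintype.card X ^ 2) *
        #(univ.filter fun S : X → T => ∀ x y, col S x y = g ((x, y), (S x, S y)))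
      < ∑ _g : Q → Fin 2, Fintype.card T ^ Fintype.card X :=
    sum_lt_sum_of_nonempty univ_nonempty fun g _ => hcon g
  have h2 : ∑ _S : X → T, 2 ^ Fintype.card Q ≤ ∑ S : X → T, 2 ^ (Fintype.card X ^ 2) *
      #(univ.filter fun g : Q → Fin 2 => ∀ x y, col S x y = g ((x, y), (S x, S y))) :=
    sum_le_sum fun S _ => key S
  rw [← mul_sum] at h1 h2
  have h3 : ∑ g : Q → Fin 2,
        #(univ.filter fun S : X → T => ∀ x y, col S x y = g ((x, y), (S x, S y)))
      = ∑ S : X → T, #(univ.filter fun g : Q → Fin 2 =>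
        ∀ x y, col S x y = g ((x, y), (S x, S y))) := by
    simp only [card_filter]
    exact sum_comm
  rw [h3] at h1
  simp at h1 h2
  rw [mul_comm] at h2
  exact absurd (h2.trans_lt h1) (lt_irrefl _)

end TriangleRamsey

/-! ### From edges to triangles -/

namespace TriangleRamsey

open Finset

/-- The `t`-fold blow-up of `H`, in which `(x, i)` and `(y, j)` are adjacent when `x` and `y` are,
together with an independent set of vertices, one for each section `S : Fin r → Fin t` of the
blow-up; the vertex `S` is adjacent to the points `(x, S x)` of its graph. -/
def sectionGraph {r : ℕ} (H : SimpleGraph (Fin r)) (t : ℕ) :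
    SimpleGraph ((Fin r × Fin t) ⊕ (Fin r → Fin t)) where
  Adj
    | .inl p, .inl q => H.Adj p.1 q.1
    | .inl p, .inr S => S p.1 = p.2
    | .inr S, .inl p => S p.1 = p.2
    | .inr _, .inr _ => False
  symm := ⟨by
    rintro (p | S) (q | S') h
    · exact H.adj_symm h
    · exact h
    · exact h
    · exact h⟩
  loopless := ⟨by
    rintro (p | S) h
    · exact H.irrefl h
    · exact h⟩

/-- If every 2-colouring of the edges of `H` has a monochromatic induced copy of `F ∈ classB n`,
then every 2-colouring of the triangles of a section graph over `H` with large fibres has an induced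
copy of `F` whose triangles have one colour. -/
theorem arrows_sectionGraph {n r t : ℕ} {F : SimpleGraph (Fin n)} (hF : F ∈ classB n)
    {H : SimpleGraph (Fin r)}
    (hH : ∀ g : Fin r → Fin r → Fin 2, (∀ x y, H.Adj x y → g x y = g y x) →
      ∃ φ : F ↪g H, ∃ c, ∀ a b, F.Adj a b → g (φ a) (φ b) = c)
    (ht : r * 2 ^ (r ^ 2) < t) : Arrows (sectionGraph H t) F := by
  classical
  obtain ⟨A, B, hAB, -, hA, hB⟩ := hF
  intro χ
  have htpos : 0 < t := by omega
  have hclique : ∀ (S : Fin r → Fin t) x y, H.Adj x y →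
      ({.inl (x, S x), .inl (y, S y), .inr S} : Finset ((Fin r × Fin t) ⊕ (Fin r → Fin t)))
        ∈ (sectionGraph H t).cliqueSet 3 := by
    intro S x y h
    rw [SimpleGraph.mem_cliqueSet_iff, SimpleGraph.is3Clique_triple_iff]
    exact ⟨h, rfl, rfl⟩
  let col : (Fin r → Fin t) → Fin r → Fin r → Fin 2 := fun S x y =>
    if h : H.Adj x y then χ ⟨_, hclique S x y h⟩ else 0
  have hcol : ∀ S x y, col S x y = col S y x := by
    intro S x y
    by_cases h : H.Adj x y
    · simp only [col, h, h.symm, dif_pos]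
      congr 2
      exact insert_comm _ _ _
    · have h' : ¬ H.Adj y x := fun h' => h h'.symm
      simp only [col, h, h', dif_neg, not_false_eq_true]
  obtain ⟨g, 𝒮, h𝒮, hg⟩ := exists_popular_colouring col
  simp only [Fintype.card_fin] at hg
  obtain ⟨u, hu⟩ : ∃ u : Fin r → Fin t, ∀ N : Set (Fin r), ∃ S ∈ 𝒮, ∀ x, S x = u x ↔ x ∈ N := by
    refine exists_shattered htpos r 𝒮 ?_
    have h1 : 0 < #𝒮 := by
      by_contra h0
      have h0' : #𝒮 = 0 := by omega
      rw [h0', mul_zero] at hg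
      exact absurd hg (not_le.2 (pow_pos htpos _))
    calc r * t ^ r ≤ r * (2 ^ (r ^ 2) * #𝒮) := Nat.mul_le_mul_left _ hg
      _ = (r * 2 ^ (r ^ 2)) * #𝒮 := by ring
      _ < t * #𝒮 := Nat.mul_lt_mul_of_pos_right ht h1
  have hval : ∀ S ∈ 𝒮, ∀ x y, S x = u x → S y = u y → col S x y = g ((x, y), (u x, u y)) := by
    intro S hS x y hx hy
    rw [h𝒮 S hS x y, hx, hy]
  obtain ⟨φ, c, hφ⟩ := hH (fun x y => g ((x, y), (u x, u y))) (by
    intro x y _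
    obtain ⟨S, hS, hSu⟩ := hu Set.univ
    have hx := (hSu x).2 (Set.mem_univ _)
    have hy := (hSu y).2 (Set.mem_univ _)
    rw [← hval S hS x y hx hy, ← hval S hS y x hy hx, hcol])
  -- the vertex `b` of `B` goes to a section that meets `u` exactly above the neighbours of `b` in
  -- `A` and above `φ b` itself; the latter makes the sections of different `b` distinct
  choose S hS hSu using fun b : Fin n => hu {x | x = φ b ∨ ∃ a ∈ A, F.Adj a b ∧ x = φ a}
  have hSA : ∀ b, b ∉ A → ∀ a ∈ A, S b (φ a) = u (φ a) ↔ F.Adj a b := by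
    intro b hb a ha
    rw [hSu]
    constructor
    · rintro (h | ⟨a', _, h, h'⟩)
      · exact absurd (φ.injective h ▸ ha) hb
      · rwa [φ.injective h']
    · exact fun h => Or.inr ⟨a, ha, h, rfl⟩
  have hBmem : ∀ b, b ∉ A → b ∈ B := by
    intro b hb
    have : b ∈ A ∪ B := hAB ▸ Set.mem_univ b
    exact this.resolve_left hb
  have hBB : ∀ b b', b ∉ A → b' ∉ A → ¬ F.Adj b b' := fun b b' hb hb' h =>
    hB (hBmem b hb) (hBmem b' hb') h.ne h
  let f : Fin n → (Fin r × Fin t) ⊕ (Fin r → Fin t) := fun a =>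
    if a ∈ A then .inl (φ a, u (φ a)) else .inr (S a)
  have fA : ∀ a ∈ A, f a = .inl (φ a, u (φ a)) := fun a ha => if_pos ha
  have fB : ∀ a, a ∉ A → f a = .inr (S a) := fun a ha => if_neg ha
  have hinj : Function.Injective f := by
    intro a b hab
    by_cases ha : a ∈ A <;> by_cases hb : b ∈ A
    · rw [fA a ha, fA b hb, Sum.inl.injEq, Prod.mk.injEq] at hab
      exact φ.injective hab.1
    · rw [fA a ha, fB b hb] at hab
      exact absurd hab (by simp)
    · rw [fB a ha, fA b hb] at hab
      exact absurd hab (by simp)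
    · rw [fB a ha, fB b hb, Sum.inr.injEq] at hab
      have h1 : S a (φ a) = u (φ a) := (hSu a _).2 (Or.inl rfl)
      rw [hab] at h1
      rcases (hSu b _).1 h1 with h | ⟨a', ha', -, h⟩
      · exact φ.injective h
      · exact absurd (φ.injective h ▸ ha') ha
  let Φ : F ↪g sectionGraph H t :=
    { toFun := f
      inj' := hinj
      map_rel_iff' := by
        intro a b
        change (sectionGraph H t).Adj (f a) (f b) ↔ F.Adj a b
        by_cases ha : a ∈ A <;> by_cases hb : b ∈ A
        · rw [fA a ha, fA b hb]
          exact φ.map_adj_iff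
        · rw [fA a ha, fB b hb]
          exact hSA b hb a ha
        · rw [fB a ha, fA b hb]
          exact (hSA a ha b hb).trans (F.adj_comm _ _)
        · rw [fB a ha, fB b hb]
          exact iff_of_false id (hBB a b ha hb) }
  have hmain : ∀ (T : (sectionGraph H t).cliqueSet 3) a a' b, a ∈ A → a' ∈ A → b ∉ A →
      F.Adj a a' → F.Adj a b → F.Adj a' b →
      (T : Finset ((Fin r × Fin t) ⊕ (Fin r → Fin t))) = {f a, f a', f b} → χ T = c := by
    intro T a a' b ha ha' hb h1 h2 h3 hT
    have e1 := (hSA b hb a ha).2 h2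
    have e2 := (hSA b hb a' ha').2 h3
    rw [← hφ a a' h1, ← hval (S b) (hS b) _ _ e1 e2]
    have h4 : H.Adj (φ a) (φ a') := φ.map_adj_iff.2 h1
    simp only [col, h4, dif_pos]
    congr 1
    apply Subtype.ext
    change (T : Finset ((Fin r × Fin t) ⊕ (Fin r → Fin t)))
      = {.inl (φ a, S b (φ a)), .inl (φ a', S b (φ a')), .inr (S b)}
    rw [hT, fA a ha, fA a' ha', fB b hb, e1, e2]
  refine ⟨Φ, c, fun T hT => ?_⟩
  obtain ⟨p, q, s, hpq, hps, hqs, hTe⟩ := SimpleGraph.is3Clique_iff.1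
    ((SimpleGraph.mem_cliqueSet_iff).1 T.2)
  obtain ⟨i, rfl⟩ : p ∈ Set.range Φ := hT (by simp [hTe])
  obtain ⟨j, rfl⟩ : q ∈ Set.range Φ := hT (by simp [hTe])
  obtain ⟨l, rfl⟩ : s ∈ Set.range Φ := hT (by simp [hTe])
  replace hTe : (T : Finset ((Fin r × Fin t) ⊕ (Fin r → Fin t))) = {f i, f j, f l} := hTe
  have hij : F.Adj i j := Φ.map_adj_iff.1 hpq
  have hil : F.Adj i l := Φ.map_adj_iff.1 hps
  have hjl : F.Adj j l := Φ.map_adj_iff.1 hqs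
  by_cases hi : i ∈ A <;> by_cases hj : j ∈ A <;> by_cases hl : l ∈ A
  · exfalso
    refine hA {⟨i, hi⟩, ⟨j, hj⟩, ⟨l, hl⟩} ?_
    rw [SimpleGraph.is3Clique_triple_iff]
    exact ⟨hij, hil, hjl⟩
  · exact hmain T i j l hi hj hl hij hil hjl hTe
  · refine hmain T i l j hi hl hj hil hij hjl.symm (hTe.trans ?_)
    rw [pair_comm (f j) (f l)]
  · exact absurd hjl (hBB j l hj hl)
  · refine hmain T j l i hj hl hi hjl hij.symm hil.symm (hTe.trans ?_)
    rw [insert_comm (f i) (f j), pair_comm (f i) (f l)]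
  · exact absurd hil (hBB i l hi hl)
  · exact absurd hij (hBB i j hi hj)
  · exact absurd hij (hBB i j hi hj)

end TriangleRamsey

/-! ### The symplectic graph and pseudo-randomness -/

namespace TriangleRamsey

open Finset
open scoped Classical

/-- The symplectic form on `𝔽₂ᵈ × 𝔽₂ᵈ`. -/
def sympl {d : ℕ} (x y : (Fin d → ZMod 2) × (Fin d → ZMod 2)) : ZMod 2 :=
  x.1 ⬝ᵥ y.2 + x.2 ⬝ᵥ y.1

lemma sympl_self {d : ℕ} (x : (Fin d → ZMod 2) × (Fin d → ZMod 2)) : sympl x x = 0 := by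
  rw [sympl, dotProduct_comm x.2]
  exact CharTwo.add_self_eq_zero _

lemma sympl_comm {d : ℕ} (x y : (Fin d → ZMod 2) × (Fin d → ZMod 2)) :
    sympl x y = sympl y x := by
  rw [sympl, sympl, dotProduct_comm x.2, dotProduct_comm x.1, add_comm]

lemma sympl_add_right {d : ℕ} (x y z : (Fin d → ZMod 2) × (Fin d → ZMod 2)) :
    sympl x (y + z) = sympl x y + sympl x z := by
  simp only [sympl, Prod.fst_add, Prod.snd_add, dotProduct_add]
  ring

/-- The symplectic graph: two vectors are adjacent when their symplectic product is `1`. -/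
def symplGraph (d : ℕ) : SimpleGraph ((Fin d → ZMod 2) × (Fin d → ZMod 2)) where
  Adj x y := sympl x y = 1
  symm := ⟨fun x y h => by rw [sympl_comm]; exact h⟩
  loopless := ⟨fun x h => by rw [sympl_self] at h; exact absurd h (by decide)⟩

lemma exists_sympl_eq_one {d : ℕ} {u : (Fin d → ZMod 2) × (Fin d → ZMod 2)} (hu : u ≠ 0) :
    ∃ w, sympl u w = 1 := by
  have hz : ∀ z : ZMod 2, z ≠ 0 → z = 1 := by decide
  by_cases h1 : u.1 = 0
  · have h2 : u.2 ≠ 0 := fun h2 => hu (Prod.ext h1 h2)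
    obtain ⟨i, hi⟩ := Function.ne_iff.1 h2
    exact ⟨(Pi.single i 1, 0), by simp [sympl, hz _ hi]⟩
  · obtain ⟨i, hi⟩ := Function.ne_iff.1 h1
    exact ⟨(0, Pi.single i 1), by simp [sympl, hz _ hi]⟩

/-- The additive character `z ↦ (-1) ^ z` of `𝔽₂`. -/
def sgn (z : ZMod 2) : ℝ := if z = 1 then -1 else 1

lemma sgn_add (a b : ZMod 2) : sgn (a + b) = sgn a * sgn b := by
  have : ∀ a : ZMod 2, a = 0 ∨ a = 1 := by decide
  rcases this a with rfl | rfl <;> rcases this b with rfl | rfl <;>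
    simp [sgn, CharTwo.add_self_eq_zero]

lemma sum_sgn_sympl {d : ℕ} (u : (Fin d → ZMod 2) × (Fin d → ZMod 2)) :
    ∑ x, sgn (sympl u x) = if u = 0 then (4 : ℝ) ^ d else 0 := by
  split_ifs with hu
  · subst hu
    have : ∀ x : (Fin d → ZMod 2) × (Fin d → ZMod 2), sgn (sympl 0 x) = 1 := by
      intro x; simp [sympl, sgn]
    simp only [this, sum_const, card_univ, Fintype.card_prod, Fintype.card_fun, ZMod.card,
      Fintype.card_fin, nsmul_eq_mul, mul_one]
    push_cast
    rw [← mul_pow]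
    norm_num
  · obtain ⟨w, hw⟩ := exists_sympl_eq_one hu
    -- translation by `w` changes the sign of every term
    have h1 : ∑ x, sgn (sympl u x) = ∑ x, sgn (sympl u (x + w)) :=
      (Equiv.sum_comp (Equiv.addRight w) fun x => sgn (sympl u x)).symm
    have h2 : ∀ x, sgn (sympl u (x + w)) = - sgn (sympl u x) := by
      intro x
      rw [sympl_add_right, sgn_add, hw]
      simp [sgn]
    simp only [h2, sum_neg_distrib] at h1
    linarith

/-- Parseval's identity for the indicator function of `T`. -/
lemma sum_sq_sum_sgn {d : ℕ} (T : Finset ((Fin d → ZMod 2) × (Fin d → ZMod 2))) :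
    ∑ x, (∑ y ∈ T, sgn (sympl x y)) ^ 2 = (4 : ℝ) ^ d * #T := by
  have h0 : ∀ y z : (Fin d → ZMod 2) × (Fin d → ZMod 2), y + z = 0 ↔ z = y := by
    intro y z
    rw [add_eq_zero_iff_eq_neg]
    have : -z = z := by
      ext i
      · exact ZMod.neg_eq_self_mod_two _
      · exact ZMod.neg_eq_self_mod_two _
    rw [this, eq_comm]
  calc ∑ x, (∑ y ∈ T, sgn (sympl x y)) ^ 2
      = ∑ x, ∑ y ∈ T, ∑ z ∈ T, sgn (sympl (y + z) x) := by
        refine sum_congr rfl fun x _ => ?_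
        rw [sq, sum_mul_sum]
        refine sum_congr rfl fun y _ => sum_congr rfl fun z _ => ?_
        rw [← sgn_add, ← sympl_add_right, sympl_comm]
    _ = ∑ y ∈ T, ∑ z ∈ T, ∑ x, sgn (sympl (y + z) x) := by
        rw [sum_comm]
        exact sum_congr rfl fun y _ => sum_comm
    _ = ∑ y ∈ T, (4 : ℝ) ^ d := by
        refine sum_congr rfl fun y hy => ?_
        simp only [sum_sgn_sympl, h0]
        rw [sum_ite_eq' T y, if_pos hy]
    _ = _ := by rw [sum_const, nsmul_eq_mul, mul_comm]

/-- `x` splits `T` evenly in `Γ`, up to an error of `ε * |V|`. -/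
def Splits {α : Type*} (Γ : SimpleGraph α) (ε : ℝ) (V T : Finset α) (x : α) : Prop :=
  |(#(T.filter (Γ.Adj x)) : ℝ) - #T / 2| ≤ ε * #V

/-- Pseudo-randomness: all but `E` vertices split every subset `T` of a set `V` of at least `μ`
vertices evenly, up to an error of `ε * |V|`. -/
def PseudoRandom {α : Type*} [Fintype α] (Γ : SimpleGraph α) (ε μ E : ℝ) : Prop :=
  ∀ V T : Finset α, T ⊆ V → μ ≤ #V → (#(univ.filter fun x => ¬ Splits Γ ε V T x) : ℝ) ≤ E

lemma pseudoRandom_symplGraph (d : ℕ) {ε μ : ℝ} (hε : 0 < ε) (hμ : 0 < μ) :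
    PseudoRandom (symplGraph d) ε μ (4 ^ d / (ε ^ 2 * μ)) := by
  intro V T hTV hV
  have hs : ∀ x, ∑ y ∈ T, sgn (sympl x y)
      = #T - 2 * (#(T.filter ((symplGraph d).Adj x)) : ℝ) := by
    intro x
    have : ∀ y, sgn (sympl x y) = 1 - 2 * if (symplGraph d).Adj x y then (1 : ℝ) else 0 := by
      intro y
      by_cases h : sympl x y = 1
      · have h' : (symplGraph d).Adj x y := h
        simp only [sgn, h, h', if_true]; norm_num
      · have h' : ¬ (symplGraph d).Adj x y := h
        simp only [sgn, h, h', if_false]; norm_num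
    simp only [this, sum_sub_distrib, ← mul_sum, sum_boole, sum_const, nsmul_eq_mul, mul_one]
  have hVpos : (0 : ℝ) < #V := hμ.trans_le hV
  set bad := univ.filter fun x => ¬ Splits (symplGraph d) ε V T x
  have h1 : (#bad : ℝ) * (ε * #V) ^ 2 ≤ 4 ^ d * #T := by
    rw [← sum_sq_sum_sgn T]
    calc (#bad : ℝ) * (ε * #V) ^ 2 = ∑ _x ∈ bad, (ε * #V) ^ 2 := by simp
      _ ≤ ∑ x ∈ bad, (∑ y ∈ T, sgn (sympl x y)) ^ 2 := by
          refine sum_le_sum fun x hx => ?_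
          have hx' := (mem_filter.1 hx).2
          rw [Splits, not_le] at hx'
          rw [hs x, ← sq_abs (_ - _)]
          refine pow_le_pow_left₀ (by positivity) ?_ 2
          refine hx'.le.trans ?_
          rw [show (#T : ℝ) - 2 * #(T.filter ((symplGraph d).Adj x))
            = (-2) * (#(T.filter ((symplGraph d).Adj x)) - #T / 2) by ring, abs_mul]
          norm_num
          linarith [abs_nonneg ((#(T.filter ((symplGraph d).Adj x)) : ℝ) - #T / 2)]
      _ ≤ _ := sum_le_sum_of_subset_of_nonneg (subset_univ _) fun _ _ _ => sq_nonneg _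
  have h2 : (#T : ℝ) ≤ #V := by exact_mod_cast card_le_card hTV
  rw [le_div_iff₀ (by positivity)]
  have h3 : (#bad : ℝ) * (ε ^ 2 * #V) * #V ≤ 4 ^ d * #V := by
    calc _ = (#bad : ℝ) * (ε * #V) ^ 2 := by ring
      _ ≤ 4 ^ d * #T := h1
      _ ≤ 4 ^ d * #V := by gcongr
  have h4 := le_of_mul_le_mul_right h3 hVpos
  refine le_trans ?_ h4
  gcongr

end TriangleRamsey

/-! ### Ladders in one of two colours -/

namespace TriangleRamsey

open Finset
open scoped Classical

section Ladders

variable {α : Type*} (Γ : SimpleGraph α) (g : α → α → Fin 2)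

/-- The neighbours of `x` in `V` along edges of colour `c`. The other colour is `c + 1`. -/
noncomputable def colourNbrs (c : Fin 2) (x : α) (V : Finset α) : Finset α :=
  V.filter fun y => Γ.Adj x y ∧ g x y = c

/-- Any two subsets of `W` of relative size at least `ρ` have density at least `δ` in colour `c`
between them. -/
def BiDense (c : Fin 2) (δ ρ : ℝ) (W : Finset α) : Prop :=
  ∀ X Y : Finset α, X ⊆ W → Y ⊆ W → ρ * #W ≤ #X → ρ * #W ≤ #Y →
    δ * #X * #Y ≤ ∑ x ∈ X, (#(colourNbrs Γ g c x Y) : ℝ)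

/-- A place for a copy in colour `c` of any graph on `s` vertices: vertex `p` is to be chosen in the
set `W p ⊆ U`, in the order `0, 1, …, s - 1`. The positions form consecutive blocks, the block of
`q` starting at `st q` and having `len q` positions. All sets of a block are the same set, in which
colour `c` is bi-dense, with the parameter `ρ` depending on the length of the block. If `p` comes in
an earlier block than `q`, then each vertex of `W p` has few neighbours in `W q` in the other
colour. -/
def Ladder (δ η m : ℝ) (ρ : ℕ → ℝ) (c : Fin 2) (s : ℕ) (U : Finset α) : Prop :=
  ∃ (W : ℕ → Finset α) (st len : ℕ → ℕ),
    (∀ p < s, W p ⊆ U ∧ m ≤ #(W p) ∧ p < st p + len p) ∧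
    ∀ p q, p < q → q < s →
      (st q ≤ p → st p = st q ∧ W p = W q ∧ BiDense Γ g c δ (ρ (len q)) (W q)) ∧
      (p < st q → ∀ x ∈ W p, (#(colourNbrs Γ g (c + 1) x (W q)) : ℝ) ≤ η * #(W q))

variable {Γ g} {δ η m : ℝ} {ρ : ℕ → ℝ} {c : Fin 2}

lemma Ladder.mono {s : ℕ} {U U' : Finset α} (h : Ladder Γ g δ η m ρ c s U) (hU : U ⊆ U') :
    Ladder Γ g δ η m ρ c s U' := by
  obtain ⟨W, st, len, h1, h2⟩ := h
  exact ⟨W, st, len, fun p hp => ⟨(h1 p hp).1.trans hU, (h1 p hp).2⟩, h2⟩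

lemma ladder_one {U : Finset α} (hU : m ≤ #U) : Ladder Γ g δ η m ρ c 1 U :=
  ⟨fun _ => U, fun _ => 0, fun _ => 1, fun p hp => ⟨Subset.rfl, hU, by omega⟩,
    fun p q hpq hq => by omega⟩

lemma ladder_of_biDense {s : ℕ} {U : Finset α} (hU : m ≤ #U) (h : BiDense Γ g c δ (ρ s) U) :
    Ladder Γ g δ η m ρ c s U :=
  ⟨fun _ => U, fun _ => 0, fun _ => s, fun p hp => ⟨Subset.rfl, hU, by simpa using hp⟩,
    fun p q _ _ => ⟨fun _ => ⟨rfl, rfl, h⟩, fun h' => absurd h' (Nat.not_lt_zero p)⟩⟩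

/-- A ladder in a set `Y` can be put before a ladder `W` in a set `X` if the vertices of `Y` have few
neighbours of the wrong colour in each `W p`. -/
lemma Ladder.append {s t : ℕ} {U Y : Finset α} (hY : Ladder Γ g δ η m ρ c s Y) (hYU : Y ⊆ U)
    {W : ℕ → Finset α} {st len : ℕ → ℕ}
    (h1 : ∀ p < t, W p ⊆ U ∧ m ≤ #(W p) ∧ p < st p + len p)
    (h2 : ∀ p q, p < q → q < t →
      (st q ≤ p → st p = st q ∧ W p = W q ∧ BiDense Γ g c δ (ρ (len q)) (W q)) ∧
      (p < st q → ∀ x ∈ W p, (#(colourNbrs Γ g (c + 1) x (W q)) : ℝ) ≤ η * #(W q)))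
    (h3 : ∀ y ∈ Y, ∀ q < t, (#(colourNbrs Γ g (c + 1) y (W q)) : ℝ) ≤ η * #(W q)) :
    Ladder Γ g δ η m ρ c (s + t) U := by
  obtain ⟨W', st', len', h1', h2'⟩ := hY
  refine ⟨fun p => if p < s then W' p else W (p - s),
    fun p => if p < s then st' p else s + st (p - s),
    fun p => if p < s then len' p else len (p - s), ?_, ?_⟩
  · intro p hp
    by_cases hps : p < s
    · simp only [hps, if_true]
      exact ⟨(h1' p hps).1.trans hYU, (h1' p hps).2⟩
    · simp only [hps, if_false]
      obtain ⟨a, b, e⟩ := h1 (p - s) (by omega)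
      exact ⟨a, b, by omega⟩
  · intro p q hpq hq
    by_cases hqs : q < s
    · have hps : p < s := hpq.trans hqs
      simp only [hps, hqs, if_true]
      exact h2' p q hpq hqs
    · by_cases hps : p < s
      · simp only [hps, hqs, if_true, if_false]
        exact ⟨fun h => by omega, fun _ x hx => h3 x ((h1' p hps).1 hx) _ (by omega)⟩
      · simp only [hps, hqs, if_false]
        obtain ⟨a, b⟩ := h2 (p - s) (q - s) (by omega) (by omega)
        refine ⟨fun h => ?_, fun h => b (by omega)⟩
        obtain ⟨e1, e2⟩ := a (by omega)
        exact ⟨by omega, e2⟩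

lemma sum_card_colourNbrs_comm (hg : ∀ x y, Γ.Adj x y → g x y = g y x) (X Y : Finset α) :
    ∑ x ∈ X, (#(colourNbrs Γ g c x Y) : ℝ) = ∑ y ∈ Y, (#(colourNbrs Γ g c y X) : ℝ) := by
  have h : ∀ x y, (Γ.Adj x y ∧ g x y = c) ↔ (Γ.Adj y x ∧ g y x = c) := by
    intro x y
    constructor
    · rintro ⟨h, h'⟩; exact ⟨h.symm, by rw [← hg x y h, h']⟩
    · rintro ⟨h, h'⟩; exact ⟨h.symm, by rw [← hg y x h, h']⟩
  have h1 := sum_card_bipartiteAbove_eq_sum_card_bipartiteBelow (s := X) (t := Y)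
    fun x y => Γ.Adj x y ∧ g x y = c
  simp only [bipartiteAbove, bipartiteBelow, h] at h1
  have h3 : ∑ x ∈ X, #(Y.filter fun y => Γ.Adj x y ∧ g x y = c)
      = ∑ y ∈ Y, #(X.filter fun x => Γ.Adj y x ∧ g y x = c) := by
    rw [← h1]
  simp only [colourNbrs]
  exact_mod_cast h3

/-- Markov's inequality in counting form. -/
lemma card_filter_lt_mul_le {β : Type*} (X : Finset β) (f : β → ℝ) (hf : ∀ x ∈ X, 0 ≤ f x) (a : ℝ) :
    (#(X.filter fun x => a < f x) : ℝ) * a ≤ ∑ x ∈ X, f x := by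
  calc (#(X.filter fun x => a < f x) : ℝ) * a = ∑ _x ∈ X.filter fun x => a < f x, a := by simp
    _ ≤ ∑ x ∈ X.filter fun x => a < f x, f x :=
        sum_le_sum fun x hx => (mem_filter.1 hx).2.le
    _ ≤ _ := sum_le_sum_of_subset_of_nonneg (filter_subset _ _) fun x hx _ => hf x hx

/-- If colour `c` is not bi-dense in `U`, it is sparse between two large subsets `X` and `Y`, and
ladders in the other colour found in `X` and in (a large part of) `Y` fit together. -/
lemma ladder_or_ladder_double (hg : ∀ x y, Γ.Adj x y → g x y = g y x) {k s t : ℕ} {M : ℝ}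
    (hδ : 0 < δ) (hη : 0 < η) (hδη : 4 * k * δ ≤ η) (hM : 0 < M) (hm : 0 < m) (htk : t ≤ k)
    (ih : ∀ U : Finset α, M ≤ #U → Ladder Γ g δ η m ρ c s U ∨ Ladder Γ g δ η m ρ (c + 1) t U)
    {U : Finset α} (hmU : m ≤ #U) (hU : 2 * M ≤ ρ s * #U) :
    Ladder Γ g δ η m ρ c s U ∨ Ladder Γ g δ η m ρ (c + 1) (t + t) U := by
  by_cases hbd : BiDense Γ g c δ (ρ s) U
  · exact Or.inl (ladder_of_biDense hmU hbd)
  rw [BiDense] at hbd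
  push Not at hbd
  obtain ⟨X₀, Y₀, hX₀U, hY₀U, hX₀, hY₀, hlt⟩ := hbd
  have hX₀pos : (0 : ℝ) < #X₀ := by linarith
  have hY₀pos : (0 : ℝ) < #Y₀ := by linarith
  set X := X₀.filter fun x => ¬ 2 * δ * #Y₀ < #(colourNbrs Γ g c x Y₀)
  have hXcard : M ≤ #X := by
    have h1 := card_filter_lt_mul_le X₀ (fun x => (#(colourNbrs Γ g c x Y₀) : ℝ))
      (fun _ _ => by positivity) (2 * δ * #Y₀)
    have h2 : (#(X₀.filter fun x => 2 * δ * #Y₀ < #(colourNbrs Γ g c x Y₀)) : ℝ) + #X = #X₀ := by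
      exact_mod_cast card_filter_add_card_filter_not _
    have h3 : 2 * (#(X₀.filter fun x => 2 * δ * #Y₀ < #(colourNbrs Γ g c x Y₀)) : ℝ) ≤ #X₀ := by
      have hpos : 0 < δ * #Y₀ := by positivity
      refine le_of_mul_le_mul_right ?_ hpos
      linarith
    linarith
  have hXU : X ⊆ U := (filter_subset _ _).trans hX₀U
  rcases ih X hXcard with hL | ⟨W, st, len, h1, h2⟩
  · exact Or.inl (hL.mono hXU)
  set Y := Y₀.filter fun y => ∀ q < t, (#(colourNbrs Γ g c y (W q)) : ℝ) ≤ η * #(W q) with hY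
  have hYU : Y ⊆ U := (filter_subset _ _).trans hY₀U
  have hYcard : M ≤ #Y := by
    set bad : ℕ → Finset α := fun q =>
      Y₀.filter fun y => η * #(W q) < #(colourNbrs Γ g c y (W q)) with hbad
    have hb : ∀ q < t, (#(bad q) : ℝ) * η ≤ 2 * δ * #Y₀ := by
      intro q hq
      have hWpos : (0 : ℝ) < #(W q) := hm.trans_le (h1 q hq).2.1
      have h3 := card_filter_lt_mul_le Y₀ (fun y => (#(colourNbrs Γ g c y (W q)) : ℝ))
        (fun _ _ => by positivity) (η * #(W q))
      rw [← sum_card_colourNbrs_comm hg] at h3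
      have h4 : ∑ x ∈ W q, (#(colourNbrs Γ g c x Y₀) : ℝ) ≤ ∑ _x ∈ W q, 2 * δ * #Y₀ :=
        sum_le_sum fun x hx => not_lt.1 (mem_filter.1 ((h1 q hq).1 hx)).2
      rw [sum_const, nsmul_eq_mul] at h4
      refine le_of_mul_le_mul_right ?_ hWpos
      linarith
    have hsub : Y₀ ⊆ Y ∪ (range t).biUnion bad := by
      intro y hy
      by_cases hyY : y ∈ Y
      · exact mem_union_left _ hyY
      · apply mem_union_right
        rw [hY, mem_filter] at hyY
        push Not at hyY
        obtain ⟨q, hq, hlt⟩ := hyY hy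
        exact mem_biUnion.2 ⟨q, mem_range.2 hq, mem_filter.2 ⟨hy, hlt⟩⟩
    have h5 : (#Y₀ : ℝ) ≤ #Y + ∑ q ∈ range t, (#(bad q) : ℝ) := by
      exact_mod_cast (card_le_card hsub).trans ((card_union_le _ _).trans
        (Nat.add_le_add_left card_biUnion_le _))
    have h6 : (∑ q ∈ range t, (#(bad q) : ℝ)) * η ≤ k * (2 * δ * #Y₀) := by
      rw [sum_mul]
      calc _ ≤ ∑ q ∈ range t, 2 * δ * #Y₀ := sum_le_sum fun q hq => hb q (mem_range.1 hq)
        _ = t * (2 * δ * #Y₀) := by simp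
        _ ≤ _ := by gcongr
    have h7 : 2 * (∑ q ∈ range t, (#(bad q) : ℝ)) ≤ #Y₀ := by
      refine le_of_mul_le_mul_right ?_ hη
      have := mul_le_mul_of_nonneg_right hδη hY₀pos.le
      linarith
    linarith
  rcases ih Y hYcard with hL | hL
  · exact Or.inl (hL.mono hYU)
  · refine Or.inr (hL.append hYU (fun p hp => ⟨(h1 p hp).1.trans hXU, (h1 p hp).2⟩) h2 ?_)
    intro y hy q hq
    have hcc : ∀ c : Fin 2, c + 1 + 1 = c := by decide
    rw [hcc]
    exact (mem_filter.1 hy).2 q hq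

/-- Every large set has a ladder in one of the two colours. Doubling the shorter of the two ladders
first makes the losses `ρ ^ (-1)` a geometric progression. -/
lemma ladder_or_ladder (hg : ∀ x y, Γ.Adj x y → g x y = g y x) {k : ℕ} {Q D : ℝ}
    (hδ : 0 < δ) (hη : 0 < η) (hδη : 4 * k * δ ≤ η) (hm : 0 < m) (hQ : 1 ≤ Q) (hD : 1 ≤ D)
    (hρ : ∀ s, 2 ≤ ρ s * (Q * D ^ s)) (i j : ℕ) (hi : 2 ^ i ≤ k) (hj : 2 ^ j ≤ k)
    (U : Finset α) (hU : Q ^ (i + j) * D ^ (2 * (2 ^ i + 2 ^ j)) * m ≤ #U) :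
    Ladder Γ g δ η m ρ 0 (2 ^ i) U ∨ Ladder Γ g δ η m ρ 1 (2 ^ j) U := by
  have hmU : ∀ (i j : ℕ) (U : Finset α), Q ^ (i + j) * D ^ (2 * (2 ^ i + 2 ^ j)) * m ≤ #U →
      m ≤ #U := by
    intro i j U hU
    refine le_trans ?_ hU
    exact le_mul_of_one_le_left hm.le (one_le_mul_of_one_le_of_one_le (one_le_pow₀ hQ)
      (one_le_pow₀ hD))
  have hstep : ∀ (i j : ℕ) (U : Finset α), j + 1 ≥ i →
      Q ^ (i + (j + 1)) * D ^ (2 * (2 ^ i + 2 ^ (j + 1))) * m ≤ #U →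
      2 * (Q ^ (i + j) * D ^ (2 * (2 ^ i + 2 ^ j)) * m) ≤ ρ (2 ^ i) * #U := by
    intro i j U hij hU
    have hρpos : 0 < ρ (2 ^ i) := by
      have h := hρ (2 ^ i)
      by_contra h0
      have : ρ (2 ^ i) * (Q * D ^ 2 ^ i) ≤ 0 :=
        mul_nonpos_of_nonpos_of_nonneg (not_lt.1 h0) (by positivity)
      linarith
    have hpow : 2 ^ i ≤ 2 ^ (j + 1) := Nat.pow_le_pow_right (by norm_num) hij
    calc 2 * (Q ^ (i + j) * D ^ (2 * (2 ^ i + 2 ^ j)) * m)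
        ≤ (ρ (2 ^ i) * (Q * D ^ 2 ^ i)) * (Q ^ (i + j) * D ^ (2 * (2 ^ i + 2 ^ j)) * m) := by
          have := hρ (2 ^ i)
          gcongr
      _ = ρ (2 ^ i) * (Q ^ (i + (j + 1)) * D ^ (2 ^ i + 2 * (2 ^ i + 2 ^ j)) * m) := by
          rw [pow_add D (2 ^ i), ← add_assoc, pow_succ Q (i + j)]; ring
      _ ≤ ρ (2 ^ i) * (Q ^ (i + (j + 1)) * D ^ (2 * (2 ^ i + 2 ^ (j + 1))) * m) := by
          have : 2 ^ i + 2 * (2 ^ i + 2 ^ j) ≤ 2 * (2 ^ i + 2 ^ (j + 1)) := by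
            rw [pow_succ] at hpow ⊢; omega
          gcongr
      _ ≤ _ := by gcongr
  induction hn : i + j generalizing i j U with
  | zero =>
    obtain ⟨rfl, rfl⟩ : i = 0 ∧ j = 0 := by omega
    exact Or.inl (ladder_one (hmU _ _ U hU))
  | succ n ih =>
    have hQD : ∀ i j : ℕ, 0 < Q ^ (i + j) * D ^ (2 * (2 ^ i + 2 ^ j)) * m := by
      intro i j; positivity
    rcases Nat.eq_zero_or_pos i with rfl | hi0
    · exact Or.inl (ladder_one (hmU _ _ U hU))
    rcases Nat.eq_zero_or_pos j with rfl | hj0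
    · exact Or.inr (ladder_one (hmU _ _ U hU))
    by_cases hij : i ≤ j
    · obtain ⟨j, rfl⟩ : ∃ j', j = j' + 1 := ⟨j - 1, by omega⟩
      have hj' : 2 ^ j ≤ k := le_trans (Nat.pow_le_pow_right (by norm_num) (by omega)) hj
      have := ladder_or_ladder_double (c := 0) hg hδ hη hδη (hQD i j) hm hj'
        (fun U' hU' => ih i j hi hj' U' hU' (by omega)) (hmU _ _ U hU) (hstep i j U (by omega) hU)
      rw [show 2 ^ (j + 1) = 2 ^ j + 2 ^ j by ring]
      exact this
    · obtain ⟨i, rfl⟩ : ∃ i', i = i' + 1 := ⟨i - 1, by omega⟩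
      have hi' : 2 ^ i ≤ k := le_trans (Nat.pow_le_pow_right (by norm_num) (by omega)) hi
      have hU' : Q ^ (j + (i + 1)) * D ^ (2 * (2 ^ j + 2 ^ (i + 1))) * m ≤ #U := by
        rw [add_comm j, add_comm (2 ^ j)]; exact hU
      have := ladder_or_ladder_double (c := 1) (s := 2 ^ j) (t := 2 ^ i) hg hδ hη hδη (hQD i j) hm
        hi' (fun U' hU' => (ih i j hi' hj U' hU' (by omega)).symm) (hmU _ _ U hU) (by
          have := hstep j i U (by omega) hU'
          rwa [add_comm j, add_comm (2 ^ j)] at this)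
      rw [show 2 ^ (i + 1) = 2 ^ i + 2 ^ i by ring]
      exact this.symm

end Ladders

end TriangleRamsey

/-! ### Candidate sets for the embedding -/

namespace TriangleRamsey

open Finset
open scoped Classical

section Embedding

/-- Lower bound for the relative size of a candidate set after `i` vertices outside its block have
been embedded. -/
noncomputable def sizeBound (k i : ℕ) : ℝ := (1 / 2) ^ i * (1 - i / (2 * k))

/-- Upper bound for the relative degree in the wrong colour into a candidate set after `i` vertices
have been embedded. -/
noncomputable def degBound (k i : ℕ) : ℝ := (1 / 2) ^ i * (1 + i / k) / (16 * k)

lemma sizeBound_le {k i : ℕ} : sizeBound k i ≤ (1 / 2) ^ i := by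
  rw [sizeBound]
  refine mul_le_of_le_one_right (by positivity) ?_
  have : (0 : ℝ) ≤ i / (2 * k) := by positivity
  linarith

lemma le_sizeBound {k i : ℕ} (hk : 0 < k) (hi : i ≤ k) : (1 / 2 : ℝ) ^ (k + 1) ≤ sizeBound k i := by
  have hk' : (0 : ℝ) < k := by exact_mod_cast hk
  have hi' : (i : ℝ) ≤ k := by exact_mod_cast hi
  rw [sizeBound, pow_succ]
  have h1 : (1 / 2 : ℝ) ^ k ≤ (1 / 2) ^ i := pow_le_pow_of_le_one (by norm_num) (by norm_num) hi
  have h2 : (i : ℝ) / (2 * k) ≤ 1 / 2 := by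
    rw [div_le_iff₀ (by positivity)]; linarith
  exact mul_le_mul h1 (by linarith) (by norm_num) (by positivity)

lemma degBound_le {k i : ℕ} (hk : 0 < k) (hi : i ≤ k) :
    degBound k i ≤ (1 / 2) ^ i / (8 * k) := by
  have hk' : (0 : ℝ) < k := by exact_mod_cast hk
  have hi' : (i : ℝ) ≤ k := by exact_mod_cast hi
  have h2 : (i : ℝ) / k ≤ 1 := by
    rw [div_le_iff₀ (by positivity)]; linarith
  rw [degBound, div_le_div_iff₀ (by positivity) (by positivity)]
  have h3 : (0 : ℝ) < (1 / 2) ^ i := by positivity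
  have : (1 / 2 : ℝ) ^ i * (1 + i / k) ≤ (1 / 2) ^ i * 2 := by gcongr; linarith
  nlinarith

lemma le_degBound {k i : ℕ} (hk : 0 < k) (hi : i ≤ k) :
    (1 / 2 : ℝ) ^ k / (16 * k) ≤ degBound k i := by
  rw [degBound]
  have h1 : (1 / 2 : ℝ) ^ k ≤ (1 / 2) ^ i := pow_le_pow_of_le_one (by norm_num) (by norm_num) hi
  gcongr
  refine h1.trans (le_mul_of_one_le_right (by positivity) ?_)
  have : (0 : ℝ) ≤ i / k := by positivity
  linarith

lemma sizeBound_succ_le {k i : ℕ} (hk : 0 < k) (hi : i < k) {ε κ : ℝ}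
    (hεκ : ε + κ ≤ 1 / (8 * k)) :
    sizeBound k (i + 1) ≤ (1 / 2 - ε - κ) * sizeBound k i - degBound k i := by
  have hk' : (0 : ℝ) < k := by exact_mod_cast hk
  have h1 := degBound_le hk hi.le
  have h2 := sizeBound_le (k := k) (i := i)
  have h2' : 0 ≤ sizeBound k i := le_trans (by positivity) (le_sizeBound hk hi.le)
  have h3 : (ε + κ) * sizeBound k i ≤ 1 / (8 * k) * (1 / 2) ^ i := by
    exact (mul_le_mul_of_nonneg_right hεκ h2').trans (mul_le_mul_of_nonneg_left h2 (by positivity))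
  have h4 : sizeBound k (i + 1) = sizeBound k i / 2 - (1 / 2) ^ i / (4 * k) := by
    rw [sizeBound, sizeBound, pow_succ]
    push_cast
    field_simp
    ring
  have h5 : (1 / 2 : ℝ) ^ i / (4 * k) = 1 / (8 * k) * (1 / 2) ^ i + (1 / 2) ^ i / (8 * k) := by
    field_simp
    ring
  nlinarith

lemma sizeBound_succ_le_self {k i : ℕ} (hk : 0 < k) (hi : i < k) :
    sizeBound k (i + 1) ≤ sizeBound k i := by
  have h := sizeBound_succ_le hk hi (ε := 0) (κ := 0) (by rw [add_zero]; positivity)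
  have h1 : 0 ≤ sizeBound k i := le_trans (by positivity) (le_sizeBound hk hi.le)
  have h2 : 0 ≤ degBound k i := le_trans (by positivity) (le_degBound hk hi.le)
  linarith

lemma le_degBound_succ {k i : ℕ} (hk : 0 < k) (hi : i < k) :
    degBound k i / 2 + (1 / 2) ^ k / (16 * k ^ 2) ≤ degBound k (i + 1) := by
  have hk' : (0 : ℝ) < k := by exact_mod_cast hk
  have h1 : (1 / 2 : ℝ) ^ k ≤ (1 / 2) ^ (i + 1) :=
    pow_le_pow_of_le_one (by norm_num) (by norm_num) hi
  have h2 : degBound k (i + 1) = degBound k i / 2 + (1 / 2) ^ (i + 1) / (16 * k ^ 2) := by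
    rw [degBound, degBound, pow_succ]
    push_cast
    field_simp
    ring
  rw [h2]
  gcongr

variable {α : Type*} (Γ : SimpleGraph α) (g : α → α → Fin 2)

/-- `x` and `y` can be the images of two vertices whose adjacency is `P`, in a copy of colour
`c`. -/
def Follows (c : Fin 2) (P : Prop) (x y : α) : Prop :=
  (P → Γ.Adj x y ∧ g x y = c) ∧ (¬ P → ¬ Γ.Adj x y ∧ x ≠ y)

variable {Γ g} {c : Fin 2}

lemma Splits.card_adj_ge {ε : ℝ} {V T : Finset α} {x : α} (h : Splits Γ ε V T x) :
    (#T : ℝ) / 2 - ε * #V ≤ #(T.filter (Γ.Adj x)) := by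
  have := (abs_le.1 h).1
  linarith

lemma Splits.card_adj_le {ε : ℝ} {V T : Finset α} {x : α} (h : Splits Γ ε V T x) :
    (#(T.filter (Γ.Adj x)) : ℝ) ≤ #T / 2 + ε * #V := by
  have := (abs_le.1 h).2
  linarith

lemma card_filter_not_eq {β : Type*} (T : Finset β) (p : β → Prop) :
    (#(T.filter fun y => ¬ p y) : ℝ) = #T - #(T.filter p) := by
  have : (#(T.filter p) : ℝ) + #(T.filter fun y => ¬ p y) = #T := by
    exact_mod_cast card_filter_add_card_filter_not _
  linarith

/-- Vertices of a set `T` that follow `x` make up about half of `T` at most. -/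
lemma Splits.card_follows_le {ε : ℝ} {V T : Finset α} {x : α} (h : Splits Γ ε V T x) (P : Prop) :
    (#(T.filter (Follows Γ g c P x)) : ℝ) ≤ #T / 2 + ε * #V := by
  by_cases hP : P
  · refine le_trans ?_ h.card_adj_le
    exact_mod_cast card_le_card (monotone_filter_right T fun y _ (hy : Follows Γ g c P x y) => (hy.1 hP).1)
  · have h1 : (#(T.filter (Follows Γ g c P x)) : ℝ) ≤ #(T.filter fun y => ¬ Γ.Adj x y) := by
      exact_mod_cast card_le_card (monotone_filter_right T fun y _ (hy : Follows Γ g c P x y) => (hy.2 hP).1)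
    rw [card_filter_not_eq] at h1
    have := h.card_adj_ge
    linarith

lemma Splits.card_follows_ge_of_not {ε : ℝ} {V : Finset α} {x : α} (h : Splits Γ ε V V x)
    {P : Prop} (hP : ¬ P) : (1 / 2 - ε) * #V - 1 ≤ #(V.filter (Follows Γ g c P x)) := by
  have h1 : V.filter (fun y => ¬ Γ.Adj x y) ⊆ insert x (V.filter (Follows Γ g c P x)) := by
    intro y hy
    rw [mem_filter] at hy
    by_cases hxy : x = y
    · exact hxy ▸ mem_insert_self _ _
    · exact mem_insert_of_mem (mem_filter.2 ⟨hy.1, fun h => absurd h hP, fun _ => ⟨hy.2, hxy⟩⟩)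
  have h2 : (#(V.filter (fun y => ¬ Γ.Adj x y)) : ℝ) ≤ #(V.filter (Follows Γ g c P x)) + 1 := by
    exact_mod_cast (card_le_card h1).trans (card_insert_le _ _)
  rw [card_filter_not_eq] at h2
  have := h.card_adj_le
  linarith

lemma Splits.card_follows_ge {ε : ℝ} {V : Finset α} {x : α} (h : Splits Γ ε V V x)
    {P : Prop} (hP : P) : (1 / 2 - ε) * #V - #(colourNbrs Γ g (c + 1) x V)
      ≤ #(V.filter (Follows Γ g c P x)) := by
  have hc : ∀ c z : Fin 2, z ≠ c → z = c + 1 := by decide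
  have h1 : V.filter (Γ.Adj x) ⊆
      V.filter (Follows Γ g c P x) ∪ colourNbrs Γ g (c + 1) x V := by
    intro y hy
    rw [mem_filter] at hy
    by_cases hxy : g x y = c
    · exact mem_union_left _ (mem_filter.2 ⟨hy.1, fun _ => ⟨hy.2, hxy⟩, fun h => absurd hP h⟩)
    · exact mem_union_right _ (mem_filter.2 ⟨hy.1, hy.2, hc _ _ hxy⟩)
  have h2 : (#(V.filter (Γ.Adj x)) : ℝ)
      ≤ #(V.filter (Follows Γ g c P x)) + #(colourNbrs Γ g (c + 1) x V) := by
    exact_mod_cast (card_le_card h1).trans (card_union_le _ _)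
  have := h.card_adj_ge
  linarith

lemma filter_follows_eq (P : Prop) (hP : P) (x : α) (V : Finset α) :
    V.filter (Follows Γ g c P x) = colourNbrs Γ g c x V :=
  filter_congr fun _ _ => ⟨fun h => h.1 hP, fun h => ⟨fun _ => h, fun h' => absurd hP h'⟩⟩

/-- The candidate sets `V p ⊆ W p` for the vertices `p ≥ i` after the vertices `0, …, i - 1` have
been embedded. A candidate set loses about a half with each vertex outside its block, and at most a
factor `τ` with each vertex of its block. -/
def Candidates (Γ : SimpleGraph α) (g : α → α → Fin 2) (c : Fin 2) (k : ℕ) (τ : ℝ)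
    (W : ℕ → Finset α) (st : ℕ → ℕ) (i : ℕ) (V : ℕ → Finset α) : Prop :=
  (∀ p, i ≤ p → p < k → V p ⊆ W p ∧ sizeBound k i * τ ^ (i - st p) * #(W p) ≤ #(V p)) ∧
  ∀ p q, i ≤ p → p < q → q < k → p < st q → ∀ x ∈ V p,
    (#(colourNbrs Γ g (c + 1) x (V q)) : ℝ) ≤ degBound k i * #(W q)

/-- In a pseudo-random graph only few `x ∈ X` fail to split `T y` evenly for many `y ∈ Y`. -/
lemma PseudoRandom.card_filter_le [Fintype α] {ε μ E κ : ℝ} (h : PseudoRandom Γ ε μ E)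
    (hκ : 0 < κ) (X Y V : Finset α) (hV : μ ≤ #V) (hY : Y.Nonempty) (T : α → Finset α)
    (hT : ∀ y, T y ⊆ V) :
    (#(X.filter fun x => κ * #Y < #(Y.filter fun y => ¬ Splits Γ ε V (T y) x)) : ℝ) ≤ E / κ := by
  have h1 := card_filter_lt_mul_le X
    (fun x => (#(Y.filter fun y => ¬ Splits Γ ε V (T y) x) : ℝ)) (fun _ _ => by positivity)
    (κ * #Y)
  have h2 : ∑ x ∈ X, (#(Y.filter fun y => ¬ Splits Γ ε V (T y) x) : ℝ)
      = ∑ y ∈ Y, (#(X.filter fun x => ¬ Splits Γ ε V (T y) x) : ℝ) := by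
    exact_mod_cast sum_card_bipartiteAbove_eq_sum_card_bipartiteBelow
      (s := X) (t := Y) fun x y => ¬ Splits Γ ε V (T y) x
  have h3 : ∑ y ∈ Y, (#(X.filter fun x => ¬ Splits Γ ε V (T y) x) : ℝ) ≤ ∑ _y ∈ Y, E := by
    refine sum_le_sum fun y _ => le_trans ?_ (h V (T y) (hT y) hV)
    exact_mod_cast card_le_card (filter_subset_filter _ (subset_univ X))
  rw [sum_const, nsmul_eq_mul] at h3
  have hYpos : (0 : ℝ) < #Y := by exact_mod_cast hY.card_pos
  rw [le_div_iff₀ hκ]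
  refine le_of_mul_le_mul_right ?_ hYpos
  linarith

/-- In a bi-dense set most vertices of one large subset have many neighbours in another. -/
lemma BiDense.card_filter_le {δ ρ : ℝ} {W X Y : Finset α} (h : BiDense Γ g c δ ρ W)
    (hρ : 0 < ρ * #W) (hX : X ⊆ W) (hY : Y ⊆ W) (hYc : ρ * #W ≤ #Y) :
    (#(X.filter fun x => (#(colourNbrs Γ g c x Y) : ℝ) < δ * #Y) : ℝ) ≤ ρ * #W := by
  by_contra! hcon
  set X' := X.filter fun x => (#(colourNbrs Γ g c x Y) : ℝ) < δ * #Y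
  have h1 := h X' Y ((filter_subset _ _).trans hX) hY hcon.le hYc
  have h2 : X'.Nonempty := by
    rw [← card_pos]
    exact_mod_cast hρ.trans hcon
  have h3 : ∑ x ∈ X', (#(colourNbrs Γ g c x Y) : ℝ) < ∑ _x ∈ X', δ * #Y :=
    sum_lt_sum_of_nonempty h2 fun x hx => (mem_filter.1 hx).2
  rw [sum_const, nsmul_eq_mul] at h3
  linarith

lemma Candidates.le_card {k : ℕ} (hk : 0 < k) {τ m μ : ℝ} (hτ : 0 < τ) (hτ1 : τ ≤ 1)
    (hμ : μ ≤ (1 / 2) ^ (k + 1) * τ ^ k * m) {W : ℕ → Finset α} {st : ℕ → ℕ}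
    (hW : ∀ p < k, m ≤ #(W p)) {i : ℕ} {V : ℕ → Finset α}
    (hV : Candidates Γ g c k τ W st i V) {p : ℕ} (hip : i ≤ p) (hpk : p < k) : μ ≤ #(V p) := by
  refine hμ.trans (le_trans ?_ (hV.1 p hip hpk).2)
  have h1 : τ ^ k ≤ τ ^ (i - st p) := pow_le_pow_of_le_one hτ.le hτ1 (by omega)
  have h2 := le_sizeBound hk (i := i) (by omega)
  have h3 := hW p hpk
  have h4 : 0 ≤ sizeBound k i := le_trans (by positivity) h2
  calc (1 / 2 : ℝ) ^ (k + 1) * τ ^ k * m ≤ (1 / 2 : ℝ) ^ (k + 1) * τ ^ k * #(W p) := by gcongr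
    _ ≤ _ := by gcongr

end Embedding

end TriangleRamsey

/-! ### Embedding along a ladder -/

namespace TriangleRamsey

open Finset
open scoped Classical

section Step

variable {α : Type*} [Fintype α] {Γ : SimpleGraph α} {g : α → α → Fin 2} {c : Fin 2}

lemma two_pow_mul_half_pow_mul (n : ℕ) (x y : ℝ) : 2 ^ n * ((1 / 2) ^ n * x * y) = x * y := by
  rw [← mul_assoc, ← mul_assoc, ← mul_pow]
  norm_num

lemma div_two_pow_mul_eq (k : ℕ) (x y : ℝ) :
    x / (2 ^ (k + 3) * k) * y = (1 / 2) ^ (k + 1) * x * y / (4 * k) := by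
  rw [one_div_pow, pow_succ (2 : ℝ) (k + 2), pow_succ (2 : ℝ) (k + 1)]
  field_simp
  ring

lemma one_le_degBound_mul {k i : ℕ} (hk : 0 < k) (hi : i ≤ k) {μ w : ℝ} (hμ : 8 * k ≤ μ)
    (hw : 2 ^ (k + 1) * μ ≤ w) : 1 ≤ degBound k i * w := by
  have hk0 : (0 : ℝ) < k := by exact_mod_cast hk
  have hμ0 : 0 < μ := by linarith
  calc (1 : ℝ) = 8 * k / (8 * k) := (div_self (by positivity)).symm
    _ ≤ μ / (8 * k) := by gcongr
    _ = (1 / 2) ^ k / (16 * k) * (2 ^ (k + 1) * μ) := by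
      rw [one_div_pow, pow_succ]; field_simp; norm_num
    _ ≤ _ := mul_le_mul (le_degBound hk hi) hw (by positivity)
      (le_trans (by positivity) (le_degBound hk hi))

set_option maxHeartbeats 1000000 in
/-- One step of the embedding: some `x ∈ V i` leaves large candidate sets for all later vertices.
Three kinds of `x` are avoided: those that do not split the candidate sets evenly, those that do not
split the wrong-coloured neighbourhoods of many later candidates evenly (the few remaining
exceptional candidates are deleted), and those with small degree into the candidate sets of their
own block. -/
lemma Candidates.exists_next {k : ℕ} (hk : 0 < k) {m μ E τ ε κ : ℝ} {W : ℕ → Finset α}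
    {st len : ℕ → ℕ} (hτ : τ = 1 / (128 * k ^ 2)) (hε : ε = (1 / 2) ^ k / (16 * k ^ 2))
    (hκ : κ = 1 / (128 * k ^ 3))
    (hW : ∀ p < k, m ≤ #(W p) ∧ p < st p + len p)
    (hWW : ∀ p q, p < q → q < k → st q ≤ p →
      st p = st q ∧ W p = W q ∧ BiDense Γ g c (2 * τ) (τ ^ len q / (2 ^ (k + 3) * k)) (W q))
    (hμ : μ ≤ (1 / 2) ^ (k + 1) * τ ^ k * m) (hμ1 : 8 * k ≤ μ)
    (hE : k * E + k ^ 2 * (E / κ) < μ / 2) (hΓ : PseudoRandom Γ ε μ E) (K : ℕ → ℕ → Prop)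
    {i : ℕ} (hik : i < k) {V : ℕ → Finset α} (hV : Candidates Γ g c k τ W st i V) :
    ∃ x ∈ V i, ∃ V' : ℕ → Finset α, Candidates Γ g c k τ W st (i + 1) V' ∧
      ∀ q, i < q → q < k → V' q ⊆ V q ∧ ∀ y ∈ V' q, Follows Γ g c (K i q) x y := by
  have hk1 : (1 : ℝ) ≤ k := by exact_mod_cast hk
  have hk0 : (0 : ℝ) < k := by linarith
  have hk2 : (k : ℝ) ≤ k ^ 2 := by nlinarith
  have hτ0 : 0 < τ := by rw [hτ]; positivity
  have hτ1 : τ ≤ 1 / 128 := by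
    rw [hτ]
    apply one_div_le_one_div_of_le (by norm_num)
    nlinarith
  have hκ0 : 0 < κ := by rw [hκ]; positivity
  have hkκ : k * κ = τ := by rw [hκ, hτ]; field_simp
  have hτk : τ ≤ 1 / (16 * k) := by
    rw [hτ]
    apply one_div_le_one_div_of_le (by positivity)
    nlinarith
  have hεk : ε ≤ 1 / (16 * k) := by
    rw [hε]
    have : (1 / 2 : ℝ) ^ k ≤ 1 := pow_le_one₀ (by norm_num) (by norm_num)
    gcongr
  have hε16 : ε ≤ 1 / 16 := hεk.trans (by
    apply one_div_le_one_div_of_le (by norm_num); linarith)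
  have hsum : ε + τ ≤ 1 / (8 * k) := by
    have : (1 : ℝ) / (8 * k) = 1 / (16 * k) + 1 / (16 * k) := by field_simp; norm_num
    linarith
  have hVμ : ∀ p, i ≤ p → p < k → μ ≤ #(V p) := fun p h1 h2 =>
    hV.le_card hk hτ0 (by linarith) hμ (fun p hp => (hW p hp).1) h1 h2
  have hVpos : ∀ p, i ≤ p → p < k → (0 : ℝ) < #(V p) := fun p h1 h2 => by
    have := hVμ p h1 h2; linarith
  have ha0 : 0 < sizeBound k i := lt_of_lt_of_le (by positivity) (le_sizeBound hk hik.le)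
  -- the three kinds of vertices to avoid
  set bad₁ : ℕ → Finset α := fun q => univ.filter fun x => ¬ Splits Γ ε (V q) (V q) x with hb₁
  set bad₂ : ℕ × ℕ → Finset α := fun pq => (V i).filter fun x => κ * #(V pq.1) <
    #((V pq.1).filter fun y => ¬ Splits Γ ε (V pq.2) (colourNbrs Γ g (c + 1) y (V pq.2)) x) with hb₂
  set bad₃ : ℕ → Finset α := fun q => (V i).filter fun x =>
    st q ≤ i ∧ (#(colourNbrs Γ g c x (V q)) : ℝ) < 2 * τ * #(V q) with hb₃
  set I := Ioo i k with hI
  have hIk : (#I : ℝ) ≤ k := by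
    rw [hI, Nat.card_Ioo]; exact_mod_cast (by omega : k - i - 1 ≤ k)
  have hmemI : ∀ q ∈ I, i ≤ q ∧ q < k := fun q hq => by
    rw [hI, mem_Ioo] at hq; exact ⟨hq.1.le, hq.2⟩
  have hE0 : 0 ≤ E := le_trans (by positivity) (hΓ (V i) (V i) Subset.rfl (hVμ i le_rfl hik))
  have h₁ : ∀ q ∈ I, (#(bad₁ q) : ℝ) ≤ E := fun q hq =>
    hΓ _ _ Subset.rfl (hVμ q (hmemI q hq).1 (hmemI q hq).2)
  have h₂ : ∀ pq ∈ I ×ˢ I, (#(bad₂ pq) : ℝ) ≤ E / κ := by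
    intro pq hpq
    rw [mem_product] at hpq
    refine hΓ.card_filter_le hκ0 _ _ _ (hVμ _ (hmemI _ hpq.2).1 (hmemI _ hpq.2).2) ?_ _
      fun y => filter_subset _ _
    rw [← card_pos]
    exact_mod_cast hVpos _ (hmemI _ hpq.1).1 (hmemI _ hpq.1).2
  have h₃ : ∀ q ∈ I, (#(bad₃ q) : ℝ) ≤ #(V i) / (4 * k) := by
    intro q hq
    have hq' := hq
    rw [hI, mem_Ioo] at hq'
    by_cases hst : st q ≤ i
    · obtain ⟨e1, e2, hbd⟩ := hWW i q hq'.1 hq'.2 hst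
      have hlen : i - st q ≤ len q := by
        have := (hW q hq'.2).2; omega
      have hWpos : (0 : ℝ) < #(W q) :=
        (hVpos q hq'.1.le hq'.2).trans_le (by exact_mod_cast card_le_card (hV.1 q hq'.1.le hq'.2).1)
      have hρ : τ ^ len q / (2 ^ (k + 3) * k) * #(W q)
          ≤ sizeBound k i * τ ^ (i - st q) * #(W q) / (4 * k) := by
        have h1 : τ ^ len q ≤ τ ^ (i - st q) :=
          pow_le_pow_of_le_one hτ0.le (by linarith) hlen
        have h2 := le_sizeBound hk hik.le
        calc τ ^ len q / (2 ^ (k + 3) * k) * #(W q)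
            = (1 / 2) ^ (k + 1) * τ ^ len q * #(W q) / (4 * k) := div_two_pow_mul_eq _ _ _
          _ ≤ _ := by gcongr
      have h4k : (1 : ℝ) ≤ 4 * k := by linarith
      have h5 : (#(bad₃ q) : ℝ) ≤ τ ^ len q / (2 ^ (k + 3) * k) * #(W q) := by
        refine le_trans ?_ (hbd.card_filter_le (X := V i) (Y := V q) (by positivity)
          (e2 ▸ (hV.1 i le_rfl hik).1) (hV.1 q hq'.1.le hq'.2).1 ?_)
        · exact_mod_cast card_le_card (monotone_filter_right (V i) fun x _
            (hx : st q ≤ i ∧ (#(colourNbrs Γ g c x (V q)) : ℝ) < 2 * τ * #(V q)) => hx.2)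
        · refine hρ.trans (le_trans ?_ (hV.1 q hq'.1.le hq'.2).2)
          exact div_le_self (by positivity) h4k
      refine h5.trans (hρ.trans ?_)
      have h6 := (hV.1 i le_rfl hik).2
      rw [e1, e2] at h6
      gcongr
    · have : bad₃ q = ∅ := filter_eq_empty_iff.2 fun x _ h => hst h.1
      rw [this]
      simp only [card_empty, Nat.cast_zero]
      positivity
  obtain ⟨x, hxV, hx⟩ : ∃ x ∈ V i,
      x ∉ I.biUnion bad₁ ∪ (I ×ˢ I).biUnion bad₂ ∪ I.biUnion bad₃ := by
    by_contra! hcon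
    have h4 : #(V i) ≤ ∑ q ∈ I, #(bad₁ q) + ∑ pq ∈ I ×ˢ I, #(bad₂ pq) + ∑ q ∈ I, #(bad₃ q) := by
      refine (card_le_card hcon).trans ((card_union_le _ _).trans ?_)
      exact Nat.add_le_add ((card_union_le _ _).trans
        (Nat.add_le_add card_biUnion_le card_biUnion_le)) card_biUnion_le
    have h5 : (#(V i) : ℝ) ≤ ∑ q ∈ I, (#(bad₁ q) : ℝ) + ∑ pq ∈ I ×ˢ I, (#(bad₂ pq) : ℝ)
        + ∑ q ∈ I, (#(bad₃ q) : ℝ) := by exact_mod_cast h4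
    have h6 : ∑ q ∈ I, (#(bad₁ q) : ℝ) ≤ k * E := by
      refine (sum_le_sum h₁).trans ?_
      rw [sum_const, nsmul_eq_mul]
      gcongr
    have h7 : ∑ pq ∈ I ×ˢ I, (#(bad₂ pq) : ℝ) ≤ k ^ 2 * (E / κ) := by
      refine (sum_le_sum h₂).trans ?_
      rw [sum_const, nsmul_eq_mul, card_product, Nat.cast_mul, sq]
      gcongr
    have h8 : ∑ q ∈ I, (#(bad₃ q) : ℝ) ≤ #(V i) / 4 := by
      refine (sum_le_sum h₃).trans ?_
      rw [sum_const, nsmul_eq_mul]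
      calc (#I : ℝ) * (#(V i) / (4 * k)) ≤ k * (#(V i) / (4 * k)) := by gcongr
        _ = #(V i) / 4 := by field_simp
    have := hVμ i le_rfl hik
    linarith
  simp only [mem_union, mem_biUnion, not_or, not_exists, not_and] at hx
  obtain ⟨⟨hx₁, hx₂⟩, hx₃⟩ := hx
  have hsplit : ∀ q ∈ I, Splits Γ ε (V q) (V q) x := fun q hq => by
    by_contra h
    exact hx₁ q hq (mem_filter.2 ⟨mem_univ _, h⟩)
  -- candidates whose wrong-coloured neighbourhood in some later set is not split evenly by `x`
  set exc : ℕ → Finset α := fun p => I.biUnion fun q => (V p).filter fun y =>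
    ¬ Splits Γ ε (V q) (colourNbrs Γ g (c + 1) y (V q)) x with hexc
  have hexc_card : ∀ p ∈ I, (#(exc p) : ℝ) ≤ τ * #(V p) := by
    intro p hp
    have h1 : ∀ q ∈ I, (#((V p).filter fun y =>
        ¬ Splits Γ ε (V q) (colourNbrs Γ g (c + 1) y (V q)) x) : ℝ) ≤ κ * #(V p) := by
      intro q hq
      by_contra! h
      exact hx₂ (p, q) (mem_product.2 ⟨hp, hq⟩) (mem_filter.2 ⟨hxV, h⟩)
    calc (#(exc p) : ℝ) ≤ ∑ q ∈ I, (#((V p).filter fun y =>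
        ¬ Splits Γ ε (V q) (colourNbrs Γ g (c + 1) y (V q)) x) : ℝ) := by
          exact_mod_cast card_biUnion_le
      _ ≤ ∑ _q ∈ I, κ * #(V p) := sum_le_sum h1
      _ = #I * (κ * #(V p)) := by rw [sum_const, nsmul_eq_mul]
      _ ≤ k * (κ * #(V p)) := by gcongr
      _ = τ * #(V p) := by rw [← hkκ]; ring
  set V' : ℕ → Finset α := fun q => (V q).filter (Follows Γ g c (K i q) x) \ exc q with hV'
  have hV'V : ∀ q, V' q ⊆ V q := fun q => sdiff_subset.trans (filter_subset _ _)
  have hV'F : ∀ q, ∀ y ∈ V' q, Follows Γ g c (K i q) x y := fun q y hy =>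
    (mem_filter.1 (mem_sdiff.1 hy).1).2
  refine ⟨x, hxV, V', ⟨?_, ?_⟩, fun q _ _ => ⟨hV'V q, hV'F q⟩⟩
  · intro q hiq hq
    have hqI : q ∈ I := mem_Ioo.2 ⟨hiq, hq⟩
    obtain ⟨hVW, hsize⟩ := hV.1 q (by omega) hq
    refine ⟨(hV'V q).trans hVW, ?_⟩
    have hV'card : (#((V q).filter (Follows Γ g c (K i q) x)) : ℝ) - τ * #(V q) ≤ #(V' q) := by
      have h1 : #((V q).filter (Follows Γ g c (K i q) x)) ≤ #(V' q) + #(exc q) := by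
        have := le_card_sdiff (exc q) ((V q).filter (Follows Γ g c (K i q) x))
        simp only [hV']
        omega
      have h2 : (#((V q).filter (Follows Γ g c (K i q) x)) : ℝ) ≤ #(V' q) + #(exc q) := by
        exact_mod_cast h1
      have := hexc_card q hqI
      linarith
    have hVq := hVμ q (by omega) hq
    have hWq : (#(V q) : ℝ) ≤ #(W q) := by exact_mod_cast card_le_card hVW
    by_cases hst : st q ≤ i
    · -- within a block the candidate set shrinks by a factor of at most `τ`
      have hF : 2 * τ * #(V q) ≤ #((V q).filter (Follows Γ g c (K i q) x)) := by
        by_cases hK : K i q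
        · rw [filter_follows_eq _ hK]
          by_contra! h
          exact hx₃ q hqI (mem_filter.2 ⟨hxV, hst, h⟩)
        · refine le_trans ?_ ((hsplit q hqI).card_follows_ge_of_not hK)
          nlinarith
      have h1 : τ ^ (i + 1 - st q) = τ ^ (i - st q) * τ := by
        rw [← pow_succ]; congr 1; omega
      have h2 := sizeBound_succ_le_self hk hik
      calc sizeBound k (i + 1) * τ ^ (i + 1 - st q) * #(W q)
          ≤ sizeBound k i * (τ ^ (i - st q) * τ) * #(W q) := by rw [h1]; gcongr
        _ = τ * (sizeBound k i * τ ^ (i - st q) * #(W q)) := by ring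
        _ ≤ τ * #(V q) := by gcongr
        _ ≤ _ := by linarith
    · -- before its block begins the candidate set is roughly halved
      have e1 : i + 1 - st q = 0 := by omega
      have e2 : i - st q = 0 := by omega
      rw [e2, pow_zero, mul_one] at hsize
      rw [e1, pow_zero, mul_one]
      have hF : (1 / 2 - ε) * #(V q) - degBound k i * #(W q)
          ≤ #((V q).filter (Follows Γ g c (K i q) x)) := by
        by_cases hK : K i q
        · have h1 := (hsplit q hqI).card_follows_ge (c := c) (g := g) hK
          have h2 := hV.2 i q le_rfl hiq hq (by omega) x hxV
          linarith
        · have h1 := (hsplit q hqI).card_follows_ge_of_not (c := c) (g := g) hK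
          have h2 : 1 ≤ degBound k i * #(W q) := by
            have h3 : (2 : ℝ) ^ (k + 1) * μ ≤ #(W q) := by
              refine le_trans ?_ (hW q hq).1
              have hm : 0 ≤ m := by
                by_contra hm0
                have : (1 / 2 : ℝ) ^ (k + 1) * τ ^ k * m ≤ 0 :=
                  mul_nonpos_of_nonneg_of_nonpos (by positivity) (not_le.1 hm0).le
                linarith
              have h4 : τ ^ k ≤ 1 := pow_le_one₀ hτ0.le (by linarith)
              calc (2 : ℝ) ^ (k + 1) * μ ≤ 2 ^ (k + 1) * ((1 / 2) ^ (k + 1) * τ ^ k * m) := by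
                    gcongr
                _ = τ ^ k * m := two_pow_mul_half_pow_mul _ _ _
                _ ≤ m := mul_le_of_le_one_left hm h4
            exact one_le_degBound_mul hk hik.le hμ1 h3
          linarith
      have h3 := sizeBound_succ_le hk hik hsum
      have h4 : 0 ≤ 1 / 2 - ε - τ := by linarith
      calc sizeBound k (i + 1) * #(W q)
          ≤ ((1 / 2 - ε - τ) * sizeBound k i - degBound k i) * #(W q) := by gcongr
        _ = (1 / 2 - ε - τ) * (sizeBound k i * #(W q)) - degBound k i * #(W q) := by ring
        _ ≤ (1 / 2 - ε - τ) * #(V q) - degBound k i * #(W q) := by gcongr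
        _ ≤ _ := by linarith
  · intro p q hip hpq hq hst y hy
    have hpI : p ∈ I := mem_Ioo.2 ⟨hip, by omega⟩
    have hqI : q ∈ I := mem_Ioo.2 ⟨by omega, hq⟩
    have hyV := hV'V p hy
    have hys : Splits Γ ε (V q) (colourNbrs Γ g (c + 1) y (V q)) x := by
      by_contra h
      exact (mem_sdiff.1 hy).2 (mem_biUnion.2 ⟨q, hqI, mem_filter.2 ⟨hyV, h⟩⟩)
    have h1 : colourNbrs Γ g (c + 1) y (V' q)
        ⊆ (colourNbrs Γ g (c + 1) y (V q)).filter (Follows Γ g c (K i q) x) := by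
      intro z hz
      have hz' := mem_filter.1 hz
      exact mem_filter.2 ⟨mem_filter.2 ⟨hV'V q hz'.1, hz'.2⟩, hV'F q z hz'.1⟩
    have h2 : (#(colourNbrs Γ g (c + 1) y (V' q)) : ℝ)
        ≤ #((colourNbrs Γ g (c + 1) y (V q)).filter (Follows Γ g c (K i q) x)) := by
      exact_mod_cast card_le_card h1
    have h3 := hys.card_follows_le (c := c) (g := g) (K i q)
    have h4 := hV.2 p q (by omega) hpq hq hst y hyV
    have h5 : (#(V q) : ℝ) ≤ #(W q) := by
      exact_mod_cast card_le_card (hV.1 q (by omega) hq).1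
    have h6 := le_degBound_succ hk hik
    rw [← hε] at h6
    have hε0 : 0 ≤ ε := by rw [hε]; positivity
    have h7 : ε * #(V q) ≤ ε * #(W q) := by gcongr
    have h8 : (degBound k i / 2 + ε) * #(W q) ≤ degBound k (i + 1) * #(W q) := by gcongr
    linarith

/-- A ladder in a pseudo-random graph contains an induced copy in colour `c` of every graph on its
positions. -/
lemma Ladder.exists_copy {k : ℕ} (hk : 0 < k) {m μ E τ ε κ : ℝ}
    (hτ : τ = 1 / (128 * k ^ 2)) (hε : ε = (1 / 2) ^ k / (16 * k ^ 2))
    (hκ : κ = 1 / (128 * k ^ 3)) {U : Finset α}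
    (hL : Ladder Γ g (2 * τ) (1 / (16 * k)) m (fun l => τ ^ l / (2 ^ (k + 3) * k)) c k U)
    (hμ : μ ≤ (1 / 2) ^ (k + 1) * τ ^ k * m) (hμ1 : 8 * k ≤ μ)
    (hE : k * E + k ^ 2 * (E / κ) < μ / 2) (hΓ : PseudoRandom Γ ε μ E) (K : ℕ → ℕ → Prop) :
    ∃ x : ℕ → α, ∀ p q, p < q → q < k → Follows Γ g c (K p q) (x p) (x q) := by
  obtain ⟨W, st, len, h1, h2⟩ := hL
  have hk1 : (1 : ℝ) ≤ k := by exact_mod_cast hk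
  have hτ0 : 0 < τ := by rw [hτ]; positivity
  have hτ1 : τ ≤ 1 := by
    rw [hτ, div_le_one (by positivity)]; nlinarith
  have key : ∀ (n i : ℕ), i + n = k → ∀ V, Candidates Γ g c k τ W st i V →
      ∃ x : ℕ → α, (∀ p, i ≤ p → p < k → x p ∈ V p) ∧
        ∀ p q, i ≤ p → p < q → q < k → Follows Γ g c (K p q) (x p) (x q) := by
    intro n
    induction n with
    | zero =>
      intro i hi V hV
      have hW0 : (0 : ℝ) < #(W 0) := by
        refine lt_of_lt_of_le ?_ (h1 0 hk).2.1
        by_contra hm0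
        have : (1 / 2 : ℝ) ^ (k + 1) * τ ^ k * m ≤ 0 :=
          mul_nonpos_of_nonneg_of_nonpos (by positivity) (not_lt.1 hm0)
        linarith
      obtain ⟨a, -⟩ : (W 0).Nonempty := by
        rw [← card_pos]; exact_mod_cast hW0
      exact ⟨fun _ => a, fun p h h' => by omega, fun p q h h' h'' => by omega⟩
    | succ n ih =>
      intro i hi V hV
      obtain ⟨x₀, hx₀, V', hV', hVV'⟩ := hV.exists_next hk hτ hε hκ (fun p hp => (h1 p hp).2)
        (fun p q hpq hq => (h2 p q hpq hq).1) hμ hμ1 hE hΓ K (by omega)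
      obtain ⟨x, hxV, hx⟩ := ih (i + 1) (by omega) V' hV'
      refine ⟨Function.update x i x₀, ?_, ?_⟩
      · intro p hip hp
        rcases hip.eq_or_lt with rfl | hip
        · rw [Function.update_self]; exact hx₀
        · rw [Function.update_of_ne (by omega)]
          exact (hVV' p hip hp).1 (hxV p hip hp)
      · intro p q hip hpq hq
        rw [Function.update_of_ne (by omega : q ≠ i)]
        rcases hip.eq_or_lt with rfl | hip
        · rw [Function.update_self]
          exact (hVV' q hpq hq).2 _ (hxV q hpq hq)
        · rw [Function.update_of_ne (by omega)]
          exact hx p q hip hpq hq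
  obtain ⟨x, -, hx⟩ := key k 0 (by omega) W ⟨fun p _ hp => ⟨Subset.rfl, by simp [sizeBound]⟩,
    fun p q _ hpq hq hst x hx => by
      have := (h2 p q hpq hq).2 hst x hx
      simpa [degBound] using this⟩
  exact ⟨x, fun p q => hx p q (Nat.zero_le _)⟩

end Step

end TriangleRamsey

/-! ### Induced Ramsey numbers for two colours of edges -/

namespace TriangleRamsey

open Finset
open scoped Classical

lemma card_symplGraph (d : ℕ) :
    Fintype.card ((Fin d → ZMod 2) × (Fin d → ZMod 2)) = 2 ^ (2 * d) := by
  simp only [Fintype.card_prod, Fintype.card_fun, ZMod.card, Fintype.card_fin]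
  rw [two_mul, pow_add]

/-- The induced Ramsey theorem for two colours of edges: the symplectic graph on
`2 ^ O(n * log n)` vertices contains, for every colouring of its edges, a monochromatic induced copy
of every graph on `n` vertices. -/
theorem exists_monochromatic_embedding {h n d : ℕ} (hh : 1 ≤ h) (hn : n ≤ 2 ^ h)
    (hd : d = 100 * (h * 2 ^ h)) (F : SimpleGraph (Fin n))
    (g : (Fin d → ZMod 2) × (Fin d → ZMod 2) → (Fin d → ZMod 2) × (Fin d → ZMod 2) → Fin 2)
    (hg : ∀ x y, (symplGraph d).Adj x y → g x y = g y x) :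
    ∃ φ : F ↪g symplGraph d, ∃ c, ∀ a b, F.Adj a b → g (φ a) (φ b) = c := by
  obtain ⟨k, hk⟩ : ∃ k, k = 2 ^ h := ⟨_, rfl⟩
  rw [← hk] at hn hd
  have hkR : (k : ℝ) = 2 ^ h := by rw [hk]; push_cast; rfl
  have hk2 : 2 ≤ k := by
    rw [hk]; exact (pow_le_pow_right₀ (by norm_num) hh : 2 ^ 1 ≤ 2 ^ h)
  have hhk : h ≤ k := by rw [hk]; exact Nat.lt_two_pow_self.le
  have hk0 : 0 < k := by omega
  -- exponents of `Q ^ (2 * h) * D ^ (4 * k)` and of the final loss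
  obtain ⟨e', he'⟩ : ∃ e', e' = (k + 4 + h) * (h + h) + (7 + 2 * h) * (2 * (k + k)) := ⟨_, rfl⟩
  obtain ⟨e, he⟩ : ∃ e, e = e' + ((k + 1) + (7 + 2 * h) * k) := ⟨_, rfl⟩
  have hed : 2 * e + 9 * h + 2 * k + 19 < 2 * d := by
    have h1 : k ≤ h * k := Nat.le_mul_of_pos_left k hh
    have h2 : h * h ≤ h * k := Nat.mul_le_mul_left h hhk
    have h3 : 2 ≤ h * k := hk2.trans h1
    rw [he, he', hd]
    ring_nf
    ring_nf at h1 h2 h3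
    nlinarith
  have hτ : (2 : ℝ)⁻¹ ^ (7 + 2 * h) = 1 / (128 * k ^ 2) := by
    rw [hkR, inv_pow, pow_add, pow_mul']; norm_num
  have hε : (2 : ℝ)⁻¹ ^ (k + 4 + 2 * h) = (1 / 2) ^ k / (16 * k ^ 2) := by
    rw [hkR, inv_pow, pow_add, pow_add, pow_mul', one_div_pow]; field_simp; norm_num
  have hκ : (2 : ℝ)⁻¹ ^ (7 + 3 * h) = 1 / (128 * k ^ 3) := by
    rw [hkR, inv_pow, pow_add, pow_mul']; norm_num
  have hμ : (2 : ℝ) ^ (2 * d - e)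
      = (1 / 2) ^ (k + 1) * ((2 : ℝ)⁻¹ ^ (7 + 2 * h)) ^ k * 2 ^ (2 * d - e') := by
    have h1 : 2 * d - e' = (2 * d - e) + ((k + 1) + (7 + 2 * h) * k) := by omega
    rw [h1, pow_add (2 : ℝ) (2 * d - e), pow_add (2 : ℝ) (k + 1), ← pow_mul, inv_pow, one_div_pow]
    field_simp
  have hΓ := pseudoRandom_symplGraph d (ε := (2 : ℝ)⁻¹ ^ (k + 4 + 2 * h))
    (μ := (2 : ℝ) ^ (2 * d - e)) (by positivity) (by positivity)
  have hEeq : (4 : ℝ) ^ d / (((2 : ℝ)⁻¹ ^ (k + 4 + 2 * h)) ^ 2 * 2 ^ (2 * d - e))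
      = 2 ^ (2 * (k + 4 + 2 * h) + e) := by
    have h1 : (4 : ℝ) ^ d = 2 ^ (2 * d - e) * 2 ^ e := by
      rw [← pow_add, show 2 * d - e + e = 2 * d by omega, pow_mul]; norm_num
    rw [h1, ← pow_mul, inv_pow, pow_add (2 : ℝ) (2 * _), mul_comm (k + 4 + 2 * h) 2]
    field_simp
  rw [hEeq] at hΓ
  have hE : (k : ℝ) * 2 ^ (2 * (k + 4 + 2 * h) + e)
      + (k : ℝ) ^ 2 * (2 ^ (2 * (k + 4 + 2 * h) + e) / (2 : ℝ)⁻¹ ^ (7 + 3 * h))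
      < 2 ^ (2 * d - e) / 2 := by
    have h1 : (k : ℝ) ^ 2 * (2 ^ (2 * (k + 4 + 2 * h) + e) / (2 : ℝ)⁻¹ ^ (7 + 3 * h))
        = 2 ^ (2 * h + (2 * (k + 4 + 2 * h) + e) + (7 + 3 * h)) := by
      rw [hkR, inv_pow, div_inv_eq_mul, ← pow_mul, pow_add _ _ (7 + 3 * h), pow_add _ (2 * h),
        mul_comm h 2]
      ring
    have h2 : (k : ℝ) * 2 ^ (2 * (k + 4 + 2 * h) + e)
        ≤ 2 ^ (2 * h + (2 * (k + 4 + 2 * h) + e) + (7 + 3 * h)) := by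
      rw [hkR, ← pow_add]
      exact pow_le_pow_right₀ (by norm_num) (by omega)
    have h3 : 4 * (2 : ℝ) ^ (2 * h + (2 * (k + 4 + 2 * h) + e) + (7 + 3 * h))
        < 2 ^ (2 * d - e) := by
      rw [show (4 : ℝ) = 2 ^ 2 by norm_num, ← pow_add]
      exact pow_lt_pow_right₀ (by norm_num) (by omega)
    rw [h1]
    linarith
  have hμ1 : 8 * (k : ℝ) ≤ 2 ^ (2 * d - e) := by
    rw [hkR, show (8 : ℝ) = 2 ^ 3 by norm_num, ← pow_add]
    exact pow_le_pow_right₀ (by norm_num) (by omega)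
  obtain ⟨c, hL⟩ : ∃ c, Ladder (symplGraph d) g (2 * (2 : ℝ)⁻¹ ^ (7 + 2 * h)) (1 / (16 * k))
      (2 ^ (2 * d - e')) (fun l => ((2 : ℝ)⁻¹ ^ (7 + 2 * h)) ^ l / (2 ^ (k + 3) * k)) c k univ := by
    have hU : ((2 : ℝ) ^ (k + 4 + h)) ^ (h + h) * ((2 : ℝ) ^ (7 + 2 * h)) ^ (2 * (2 ^ h + 2 ^ h))
        * 2 ^ (2 * d - e') ≤ #(univ : Finset ((Fin d → ZMod 2) × (Fin d → ZMod 2))) := by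
      rw [card_univ, card_symplGraph, ← hk, ← pow_mul, ← pow_mul, ← pow_add, ← pow_add, ← he',
        show e' + (2 * d - e') = 2 * d by omega]
      push_cast
      rfl
    have hρ : ∀ s : ℕ, 2 ≤ ((2 : ℝ)⁻¹ ^ (7 + 2 * h)) ^ s / (2 ^ (k + 3) * k)
        * (2 ^ (k + 4 + h) * ((2 : ℝ) ^ (7 + 2 * h)) ^ s) := by
      intro s
      rw [hkR, inv_pow, inv_pow, show k + 4 + h = 1 + (k + 3) + h by ring, pow_add _ _ h,
        pow_add _ 1]
      apply le_of_eq
      field_simp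
    have := ladder_or_ladder (k := k) (g := g) (η := 1 / (16 * k))
      (δ := 2 * (2 : ℝ)⁻¹ ^ (7 + 2 * h)) hg (by positivity) (by positivity)
      (by rw [hτ]; apply le_of_eq; field_simp; norm_num) (by positivity)
      (one_le_pow₀ (by norm_num)) (one_le_pow₀ (by norm_num)) hρ h h hk.ge hk.ge univ hU
    rw [← hk] at this
    rcases this with hL | hL
    · exact ⟨0, hL⟩
    · exact ⟨1, hL⟩
  obtain ⟨x, hx⟩ := hL.exists_copy hk0 hτ hε hκ hμ.le hμ1 hE hΓ
    fun p q => ∃ (hp : p < n) (hq : q < n), F.Adj ⟨p, hp⟩ ⟨q, hq⟩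
  have hxF : ∀ a b : Fin n, a < b → Follows (symplGraph d) g c (F.Adj a b) (x a) (x b) := by
    intro a b hab
    have h1 := hx a b hab (b.2.trans_le hn)
    have h2 : (∃ (hp : (a : ℕ) < n) (hq : (b : ℕ) < n), F.Adj ⟨a, hp⟩ ⟨b, hq⟩) = F.Adj a b :=
      propext ⟨fun ⟨_, _, h⟩ => h, fun h => ⟨a.2, b.2, h⟩⟩
    rwa [h2] at h1
  have hadj : ∀ a b : Fin n, a < b → ((symplGraph d).Adj (x a) (x b) ↔ F.Adj a b) :=
    fun a b hab => ⟨fun h => by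
      by_contra h'
      exact ((hxF a b hab).2 h').1 h, fun h => ((hxF a b hab).1 h).1⟩
  have hne : ∀ a b : Fin n, a < b → x a ≠ x b := by
    intro a b hab
    by_cases h : F.Adj a b
    · exact ((hxF a b hab).1 h).1.ne
    · exact ((hxF a b hab).2 h).2
  refine ⟨⟨⟨fun a => x a, ?_⟩, ?_⟩, c, ?_⟩
  · intro a b hab
    rcases lt_trichotomy a b with hlt | heq | hlt
    · exact absurd hab (hne a b hlt)
    · exact heq
    · exact absurd hab.symm (hne b a hlt)
  · intro a b
    change (symplGraph d).Adj (x a) (x b) ↔ F.Adj a b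
    rcases lt_trichotomy a b with hlt | heq | hlt
    · exact hadj a b hlt
    · subst heq
      exact iff_of_false (SimpleGraph.irrefl _) (SimpleGraph.irrefl _)
    · rw [SimpleGraph.adj_comm, F.adj_comm]
      exact hadj b a hlt
  · intro a b hab
    change g (x a) (x b) = c
    rcases lt_trichotomy a b with hlt | heq | hlt
    · exact ((hxF a b hlt).1 hab).2
    · exact absurd heq hab.ne
    · rw [hg _ _ (((hxF b a hlt).1 hab.symm).1.symm)]
      exact ((hxF b a hlt).1 hab.symm).2

end TriangleRamsey

/-! ### The bound for induced triangle Ramsey numbers -/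

namespace TriangleRamsey

open Finset

lemma map_mem_cliqueSet {V W : Type*} {G : SimpleGraph V} {G' : SimpleGraph W} (e : G ≃g G')
    {n : ℕ} {s : Finset V} (hs : s ∈ G.cliqueSet n) :
    s.map e.toEquiv.toEmbedding ∈ G'.cliqueSet n := by
  rw [SimpleGraph.mem_cliqueSet_iff, SimpleGraph.isNClique_iff] at hs ⊢
  refine ⟨?_, by rw [card_map]; exact hs.2⟩
  intro x hx y hy hxy
  simp only [coe_map, Set.mem_image] at hx hy
  obtain ⟨a, ha, rfl⟩ := hx
  obtain ⟨b, hb, rfl⟩ := hy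
  exact e.map_adj_iff.2 (hs.1 ha hb fun hab => hxy (by rw [hab]))

lemma Arrows.of_iso {U V W : Type*} {F : SimpleGraph U} {G : SimpleGraph V} {G' : SimpleGraph W}
    (e : G ≃g G') (h : Arrows G F) : Arrows G' F := by
  intro χ
  obtain ⟨φ, b, hφ⟩ := h fun s => χ ⟨_, map_mem_cliqueSet e s.2⟩
  refine ⟨φ.trans e.toEmbedding, b, fun T hT => ?_⟩
  have h1 := hφ ⟨_, map_mem_cliqueSet e.symm T.2⟩ (by
    intro x hx
    simp only [coe_map, Set.mem_image] at hx
    obtain ⟨a, ha, rfl⟩ := hx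
    obtain ⟨v, rfl⟩ := hT ha
    exact ⟨v, (e.symm_apply_apply (φ v)).symm⟩)
  rw [← h1]
  congr 1
  apply Subtype.ext
  ext x
  simp only [mem_map_equiv]
  exact iff_of_eq (congrArg (· ∈ (T : Finset W)) (e.apply_symm_apply x).symm)

lemma mem_ramseySizes_of_arrows {U V : Type*} [Fintype V] {F : SimpleGraph U} {G : SimpleGraph V}
    (h : Arrows G F) {N : ℕ} (hN : Fintype.card V = N) : N ∈ ramseySizes F :=
  ⟨G.overFin hN, h.of_iso (G.overFinIso hN)⟩

/-- The size of the section graph over the symplectic graph. -/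
lemma exists_mem_ramseySizes {n h : ℕ} (hh : 1 ≤ h) (hn : n ≤ 2 ^ h) {F : SimpleGraph (Fin n)}
    (hF : F ∈ classB n) : ∃ N ∈ ramseySizes F, N ≤ 2 ^ 2 ^ (1000 * (h * 2 ^ h)) := by
  obtain ⟨d, hd⟩ : ∃ d, d = 100 * (h * 2 ^ h) := ⟨_, rfl⟩
  obtain ⟨r, hr⟩ : ∃ r, r = 2 ^ (2 * d) := ⟨_, rfl⟩
  have hcard : Fintype.card ((Fin d → ZMod 2) × (Fin d → ZMod 2)) = r := by
    rw [hr]; exact card_symplGraph d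
  set e := (symplGraph d).overFinIso hcard
  have hr2 : 2 ≤ r := by
    have hd1 : 1 ≤ 2 * d := by
      have : 1 ≤ h * 2 ^ h := Nat.mul_pos hh (by positivity)
      omega
    rw [hr]
    exact (pow_le_pow_right₀ (by norm_num) hd1 : 2 ^ 1 ≤ 2 ^ (2 * d))
  obtain ⟨t, ht⟩ : ∃ t, t = 2 ^ (r ^ 2 + r) := ⟨_, rfl⟩
  have hrt : r * 2 ^ (r ^ 2) < t := by
    rw [ht, pow_add, mul_comm]
    exact Nat.mul_lt_mul_of_pos_left Nat.lt_two_pow_self (by positivity)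
  have harr : Arrows (sectionGraph ((symplGraph d).overFin hcard) t) F := by
    refine arrows_sectionGraph hF ?_ hrt
    intro g hg
    obtain ⟨φ, c, hφ⟩ := exists_monochromatic_embedding hh hn hd F (fun x y => g (e x) (e y))
      fun x y hxy => hg _ _ (e.map_adj_iff.2 hxy)
    exact ⟨φ.trans e.toEmbedding, c, hφ⟩
  refine ⟨r * t + t ^ r, mem_ramseySizes_of_arrows harr (by simp), ?_⟩
  have ht1 : 1 ≤ t := by rw [ht]; exact Nat.one_le_two_pow
  have h1 : r * t ≤ t ^ r := by
    have h2 : r ≤ t := by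
      refine le_trans ?_ hrt.le
      exact Nat.le_mul_of_pos_right r (by positivity)
    calc r * t ≤ t * t := Nat.mul_le_mul_right t h2
      _ = t ^ 2 := (sq t).symm
      _ ≤ t ^ r := Nat.pow_le_pow_right ht1 hr2
  calc r * t + t ^ r ≤ 2 * t ^ r := by omega
    _ = 2 ^ (1 + (r ^ 2 + r) * r) := by rw [ht, ← pow_mul, pow_add, pow_one]
    _ ≤ 2 ^ (r ^ 5) := by
      apply Nat.pow_le_pow_right (by norm_num)
      have h3 : r ^ 3 * 4 ≤ r ^ 5 := by
        calc r ^ 3 * 4 ≤ r ^ 3 * (r * r) := Nat.mul_le_mul_left _ (Nat.mul_le_mul hr2 hr2)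
          _ = r ^ 5 := by ring
      have h4 : r ^ 2 ≤ r ^ 3 := Nat.pow_le_pow_right (by omega) (by norm_num)
      have h5 : 1 ≤ r ^ 3 := Nat.one_le_pow _ _ (by omega)
      have h6 : (r ^ 2 + r) * r = r ^ 3 + r ^ 2 := by ring
      omega
    _ = 2 ^ 2 ^ (1000 * (h * 2 ^ h)) := by
      rw [hr, ← pow_mul, hd]
      congr 2
      ring

end TriangleRamsey

theorem theorem2 :
    ∃ c : ℝ, 0 < c ∧ ∀ n : ℕ, 1 ≤ n → ∀ F ∈ TriangleRamsey.classB n,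
      (TriangleRamsey.ramseySizes F).Nonempty ∧
        (TriangleRamsey.ramseyNumber F : ℝ) ≤
          (2 : ℝ) ^ ((2 : ℝ) ^ (c * (n : ℝ) * Real.logb 2 (n : ℝ))) := by
  refine ⟨4000, by norm_num, fun n hn F hF => ?_⟩
  rcases hn.eq_or_lt with rfl | hn
  · -- a graph on one vertex has no triangles, so it arrows itself
    have h1 : 1 ∈ TriangleRamsey.ramseySizes F := by
      refine ⟨F, fun χ => ⟨SimpleGraph.Embedding.refl, 0, fun t _ => ?_⟩⟩
      have h3 := ((SimpleGraph.mem_cliqueSet_iff).1 t.2).card_eq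
      have h4 := Finset.card_le_univ (t : Finset (Fin 1))
      rw [Fintype.card_fin] at h4
      omega
    refine ⟨⟨1, h1⟩, ?_⟩
    have h2 : (TriangleRamsey.ramseyNumber F : ℝ) ≤ 1 := by exact_mod_cast Nat.sInf_le h1
    refine h2.trans ?_
    norm_num
  · have hh : 1 ≤ Nat.clog 2 n := Nat.clog_pos (by norm_num) hn
    obtain ⟨h, hh'⟩ : ∃ h, Nat.clog 2 n = h + 1 := ⟨Nat.clog 2 n - 1, by omega⟩
    have hle : n ≤ 2 ^ (h + 1) := hh' ▸ Nat.le_pow_clog (by norm_num) n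
    have hlt : 2 ^ h < n := by
      have := Nat.pow_pred_clog_lt_self (b := 2) (by norm_num) hn
      rwa [hh'] at this
    obtain ⟨N, hN, hNle⟩ := TriangleRamsey.exists_mem_ramseySizes (by omega) hle hF
    refine ⟨⟨N, hN⟩, ?_⟩
    have hn0 : (0 : ℝ) < n := by exact_mod_cast (by omega : 0 < n)
    have hlogh : (h : ℝ) ≤ Real.logb 2 n := by
      rw [Real.le_logb_iff_rpow_le (by norm_num) hn0, Real.rpow_natCast]
      exact_mod_cast hlt.le
    have hlog1 : 1 ≤ Real.logb 2 n := by
      rw [Real.le_logb_iff_rpow_le (by norm_num) hn0, Real.rpow_one]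
      exact_mod_cast hn
    have hexp : ((1000 * ((h + 1) * 2 ^ (h + 1)) : ℕ) : ℝ) ≤ 4000 * n * Real.logb 2 n := by
      have h2 : (2 : ℝ) ^ h ≤ n := by exact_mod_cast hlt.le
      push_cast
      rw [pow_succ]
      have h3 : ((h : ℝ) + 1) * (2 ^ h) ≤ (2 * Real.logb 2 n) * n :=
        mul_le_mul (by linarith) h2 (by positivity) (by linarith)
      linarith
    calc (TriangleRamsey.ramseyNumber F : ℝ) ≤ N := by exact_mod_cast Nat.sInf_le hN
      _ ≤ (2 ^ 2 ^ (1000 * ((h + 1) * 2 ^ (h + 1))) : ℕ) := by exact_mod_cast hNle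
      _ = (2 : ℝ) ^ ((2 : ℝ) ^ ((1000 * ((h + 1) * 2 ^ (h + 1)) : ℕ) : ℝ)) := by
        rw [Real.rpow_natCast]
        have : ((2 : ℝ) ^ (1000 * ((h + 1) * 2 ^ (h + 1))))
            = ((2 ^ (1000 * ((h + 1) * 2 ^ (h + 1))) : ℕ) : ℝ) := by push_cast; rfl
        rw [this, Real.rpow_natCast]
        push_cast
        rfl
      _ ≤ _ := by
        apply Real.rpow_le_rpow_of_exponent_le (by norm_num)
        exact Real.rpow_le_rpow_of_exponent_le (by norm_num) hexp
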